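/- Let $p>1$ and let $s,q,V:\mathbb{R}^3\to(0,\infty)$ be radially symmetric $C^2$-functions. Put $T=2\pi\sqrt{s(0)/q(0)}$ and assume: (H1)' $T\sqrt{q(x)/s(x)}>2\pi$ for all $x\in\mathbb{R}^3\setminus\{0\}$; (H2) the function $f(x)=\bigl|2\pi-T\sqrt{q(x)/s(x)}\bigr|^{1/(p-1)}$ satisfies $f(x)\to0$, $\nabla f(x)\to0$ and $D^2f(x)\to0$ as $x\to0$; (H3) $\sup_{x\in\mathbb{R}^3}\bigl|2\pi-T\sqrt{q(x)/s(x)}\bigr|\,e^{\delta(p-1)|x|}<\infty$ for some $\delta>0$; (H4) $\sup_{x\in\mathbb{R}^3}q(x)/V(x)<\infty$. Then, with the $\delta$ of (H3), the equation $$s(x)\,\partial_t^2U+\nabla\times\nabla\times U+q(x)U-V(x)|U|^{p-1}U=0,\qquad (x,t)\in\mathbb{R}^3\times\mathbb{R},$$ has a classical solution $U\in C^2(\mathbb{R}^3\times\mathbb{R};\mathbb{R}^3)$ which is $T$-periodic in $t$, is not constant in time (in particular $U\not\equiv0$), and satisfies $\sup_{\mathbb{R}^3\times\mathbb{R}}|U(x,t)|e^{\delta|x|}<\infty$.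 It is a radial gradient field: $U(x,t)=\psi(|x|,t)\frac{x}{|x|}$ for $x\neq0$, $U(0,t)=0$, and $U(x,t)=\nabla_x\bigl(\Psi(|x|,t)\bigr)$, for some real-valued functions $\psi,\Psi$ on $[0,\infty)\times\mathbb{R}$. Moreover, for every radially symmetric $C^2$-function $a:\mathbb{R}^3\to\mathbb{R}$ the phase-shifted field $U_a(x,t)=U(x,t+a(x))$ is again a classical $C^2$ solution of the same equation which is $T$-periodic in $t$, not constant in time, and satisfies $\sup_{\mathbb{R}^3\times\mathbb{R}}|U_a(x,t)|e^{\delta|x|}<\infty$; the family of all these $U_a$ has the cardinality of the continuum. -/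

import Mathlib

open Filter Topology

noncomputable section

namespace CurlCurlWave

/-- The Euclidean space `ℝ³`. -/
abbrev E3 : Type := EuclideanSpace ℝ (Fin 3)

/-- Radial symmetry of a scalar function on `ℝ³`: its value depends on `|x|` only. -/
def IsRadial (f : E3 → ℝ) : Prop :=
  ∀ x y : E3, ‖x‖ = ‖y‖ → f x = f y

/-- The partial derivative `∂F_i / ∂x_j` of a vector field at `x`. -/
def partialDeriv (F : E3 → E3) (i j : Fin 3) (x : E3) : ℝ :=
  (fderiv ℝ F x (EuclideanSpace.single j 1)) i

/-- The curl `∇ × F` of a vector field on `ℝ³`. -/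
def curl (F : E3 → E3) (x : E3) : E3 :=
  !₂[partialDeriv F 2 1 x - partialDeriv F 1 2 x,
     partialDeriv F 0 2 x - partialDeriv F 2 0 x,
     partialDeriv F 1 0 x - partialDeriv F 0 1 x]

/-- `f(x) → 0` in the `C²`-sense as `x → 0`: near `0` (with `0` removed) `f` is of class `C²`,
and `f(x)`, `∇f(x)`, `D²f(x)` tend to `0` as `x → 0`. -/
def TendsToZeroC2 (f : E3 → ℝ) : Prop :=
  (∀ᶠ x in 𝓝[≠] (0 : E3), ContDiffAt ℝ 2 f x) ∧
  Tendsto f (𝓝[≠] 0) (𝓝 0) ∧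
  Tendsto (fun x => fderiv ℝ f x) (𝓝[≠] 0) (𝓝 0) ∧
  Tendsto (fun x => fderiv ℝ (fderiv ℝ f) x) (𝓝[≠] 0) (𝓝 0)

/-- `U` is a classical (`C²` in space-time) solution on `ℝ³ × ℝ` of
`s ∂ₜ²U + ∇×∇×U + q U - V |U|^{p-1} U = 0`. -/
def IsClassicalSolutionMinus (p : ℝ) (s q V : E3 → ℝ) (U : E3 × ℝ → E3) : Prop :=
  ContDiff ℝ 2 U ∧
  ∀ (x : E3) (t : ℝ),
    s x • iteratedDeriv 2 (fun τ => U (x, τ)) t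
      + curl (curl (fun y => U (y, t))) x
      + q x • U (x, t)
      - (V x * ‖U (x, t)‖ ^ (p - 1)) • U (x, t) = 0

/-- `U` is a `T`-periodic breather of the equation with the minus sign, localized with
exponential rate `δ`: a classical solution that is `T`-periodic in time, truly
time-dependent (in particular not identically zero), and for which
`|U(x,t)| e^{δ|x|}` is bounded on `ℝ³ × ℝ`. -/
structure IsBreatherMinus (p : ℝ) (s q V : E3 → ℝ) (T δ : ℝ) (U : E3 × ℝ → E3) : Prop where
  solution : IsClassicalSolutionMinus p s q V U
  periodic : ∀ (x : E3) (t : ℝ), U (x, t + T) = U (x, t)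
  nonstationary : ∃ (x : E3) (t t' : ℝ), U (x, t) ≠ U (x, t')
  localized : BddAbove (Set.range fun z : E3 × ℝ => ‖U z‖ * Real.exp (δ * ‖z.1‖))

/-- `U(x,t) = ψ(|x|,t) x/|x|` (with value `0` at `x = 0`). -/
def IsRadialField (U : E3 × ℝ → E3) : Prop :=
  ∃ ψ : ℝ → ℝ → ℝ, ∀ (x : E3) (t : ℝ), U (x, t) = ψ ‖x‖ t • (‖x‖⁻¹ • x)

/-- `U(x,t) = ∇ₓ Ψ(|x|,t)`: at each time `U` is the gradient of a radially symmetric function. -/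
def IsRadialGradient (U : E3 × ℝ → E3) : Prop :=
  ∃ Ψ : ℝ → ℝ → ℝ, ∀ (x : E3) (t : ℝ), HasGradientAt (fun y : E3 => Ψ ‖y‖ t) (U (x, t)) x

/-- The phase-shifted field `U_a(x,t) = U(x, t + a(x))`. -/
def phaseShift (U : E3 × ℝ → E3) (a : E3 → ℝ) : E3 × ℝ → E3 :=
  fun z => U (z.1, z.2 + a z.1)

/-- All phase shifts of `U` by radially symmetric `C²`-functions. -/
def phaseShiftFamily (U : E3 × ℝ → E3) : Set (E3 × ℝ → E3) :=
  {W | ∃ a : E3 → ℝ, ContDiff ℝ 2 a ∧ IsRadial a ∧ W = phaseShift U a}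

end CurlCurlWave

end

/-! A radial field is a gradient, so its curl vanishes and the equation decouples into one ODE in
`t` for each `x`: `s y'' + q y - V |y|^{p-1} y = 0`. With `y = A z(√(q/s) t)` and `A^{p-1} = (q/V)
α` it becomes `z'' + z - α |z|^{p-1} z = 0`, normalized by `z(0) = 0`, `z'(0) = 1`. The field is
`T`-periodic if `z` has period `T √(q/s) = 2π + e(x)`, where `e ≥ 0` vanishes exactly at the origin.

Conservation of energy suggests the angle `z' = cos θ`, `z = sin θ / √(1 - c w)` with `w = α
|z|^{p-1}` and `c = potCoeff p`. Then `w` solves `potPow p w = v` with `v = α |sin θ|^{p-1}`, and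
`dt/dθ = √(1 - c w) / (1 - w) = angleTime p v`. Everything becomes an integral over `θ` in which `α`
enters only through `α |sin φ|^{p-1}`; the integrals are therefore `C²` in `α` although the weight
is merely continuous in `φ`.

The period has positive `α`-derivative (`deriv_orbitPeriod_pos`), equals `2π` at `α = 0`, and is
unbounded as `α` approaches the saddle value (`exists_le_orbitPeriod`). Hence `2π + e(x)` is the
period for a unique `α(x)`, and `α` is `C²` (`exists_orbitParameter`). The orbit is jointly `C²` in
`(α, t)` (`contDiffAt_orbit`).

At the origin the amplitude is the delicate point. Since `e = α P(α)` with `P = periodQuot p` smooth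
and positive, `A = B f` with `B = (q / (V P))^{1/(p-1)}` of class `C²` and `f = e^{1/(p-1)}`.
Hypothesis (H2) makes `f(x) x/|x|` a `C²` field (`contDiff_smul_unit`). Decay follows from (H3),
(H4), the uniform bound on orbits and the lower bound on `P`. Phase shifts keep the field radial and
the ODE autonomous. -/

/-! ### Regularity of inverses chosen pointwise. -/

theorem ContDiffAt.of_eventually_leftInverse {E F : Type*} [NormedAddCommGroup E] [NormedSpace ℝ E]
    [NormedAddCommGroup F] [NormedSpace ℝ F] [CompleteSpace E] {f : E → F} {g : F → E}
    {f' : E ≃L[ℝ] F} {a : E} {n : WithTop ℕ∞} (hf : ContDiffAt ℝ n f a)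
    (hf' : HasFDerivAt f (f' : E →L[ℝ] F) a) (hn : n ≠ 0) (hg : ∀ᶠ x in 𝓝 a, g (f x) = x) :
    ContDiffAt ℝ n g (f a) :=
  (hf.to_localInverse hf' hn).congr_of_eventuallyEq
    ((hf.hasStrictFDerivAt' hf' hn).localInverse_unique hg)

theorem ContDiffAt.of_eventually_leftInverse_real {f g : ℝ → ℝ} {f' a : ℝ} {n : WithTop ℕ∞}
    (hf : ContDiffAt ℝ n f a) (hf' : HasDerivAt f f' a) (h0 : f' ≠ 0) (hn : n ≠ 0)
    (hg : ∀ᶠ x in 𝓝 a, g (f x) = x) : ContDiffAt ℝ n g (f a) :=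
  hf.of_eventually_leftInverse (f' := ContinuousLinearEquiv.unitsEquivAut ℝ (Units.mk0 f' h0))
    (hf'.hasFDerivAt.congr_fderiv (by ext; simp)) hn hg

/-! ### Parametric primitives with a merely continuous weight. -/

namespace CurlCurlWave

/-- The parametric primitive `(α, θ) ↦ ∫₀^θ w(φ) n(α s(φ)) dφ`. -/
noncomputable def weightedPrimitive (s w n : ℝ → ℝ) (α θ : ℝ) : ℝ :=
  ∫ φ in (0 : ℝ)..θ, w φ * n (α * s φ)

/-- Keeps arguments in the domain of the profile. No lower bound is put on `α`, so that `α = 0`, the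
value needed at the origin of space, is an interior parameter. -/
theorem mul_lt_of_mem_unit {b α t : ℝ} (hb : 0 < b) (hα : α < b) (h0 : 0 ≤ t) (h1 : t ≤ 1) :
    α * t < b := by
  rcases le_or_gt α 0 with h | h
  · nlinarith
  · nlinarith

section weightedPrimitive

variable {s w n n' : ℝ → ℝ} {b : ℝ}

theorem continuous_weighted_integrand (hb : 0 < b) (hs : Continuous s) (hs0 : ∀ φ, 0 ≤ s φ)
    (hs1 : ∀ φ, s φ ≤ 1) (hw : Continuous w) (hn : ContinuousOn n (Set.Iio b)) {α : ℝ}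
    (hα : α < b) : Continuous fun φ => w φ * n (α * s φ) :=
  hw.mul (hn.comp_continuous (continuous_const.mul hs)
    fun φ => mul_lt_of_mem_unit hb hα (hs0 φ) (hs1 φ))

theorem continuousOn_weightedPrimitive (hb : 0 < b) (hs : Continuous s) (hs0 : ∀ φ, 0 ≤ s φ)
    (hs1 : ∀ φ, s φ ≤ 1) (hw : Continuous w) (hn : ContinuousOn n (Set.Iio b)) :
    ContinuousOn (fun z : ℝ × ℝ => weightedPrimitive s w n z.1 z.2) {z | z.1 < b} := by
  rw [continuousOn_iff_continuous_domRestrict]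
  have h1 : Continuous (Function.uncurry fun (x : {z : ℝ × ℝ | z.1 < b}) φ =>
      w φ * n (x.1.1 * s φ)) := by
    refine (hw.comp continuous_snd).mul (hn.comp_continuous (f := fun q : {z : ℝ × ℝ | z.1 < b} × ℝ
      => q.1.1.1 * s q.2) ?_ ?_)
    · fun_prop
    · rintro ⟨⟨⟨x, y⟩, hx⟩, φ⟩
      exact mul_lt_of_mem_unit hb hx (hs0 φ) (hs1 φ)
  exact intervalIntegral.continuous_parametric_intervalIntegral_of_continuous (a₀ := 0)
    (μ := MeasureTheory.volume) h1 (s := fun x => x.1.2) (by fun_prop)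

/-- Differentiation under the integral costs smoothness of `n` only, never of `s`: each
`α`-derivative turns `n` into `n'` and multiplies the weight by `s`, giving an integral of the same
kind. -/
theorem hasDerivAt_weightedPrimitive_left (hb : 0 < b) (hs : Continuous s) (hs0 : ∀ φ, 0 ≤ s φ)
    (hs1 : ∀ φ, s φ ≤ 1) (hw : Continuous w) (hn : ∀ v < b, HasDerivAt n (n' v) v)
    (hn' : ContinuousOn n' (Set.Iio b)) {α : ℝ} (hα : α < b) (θ : ℝ) :
    HasDerivAt (fun a => weightedPrimitive s w n a θ)
      (weightedPrimitive s (fun φ => w φ * s φ) n' α θ) α := by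
  have hnc : ContinuousOn n (Set.Iio b) := fun v hv => (hn v hv).continuousAt.continuousWithinAt
  obtain ⟨r, hr, hrb⟩ : ∃ r, 0 < r ∧ α + r < b := ⟨(b - α) / 2, by linarith, by linarith⟩
  have hlt : ∀ a ∈ Metric.closedBall α r, a < b := by
    intro a ha
    rw [Metric.mem_closedBall, Real.dist_eq, abs_le] at ha
    linarith [ha.2]
  obtain ⟨C, hC⟩ := ((isCompact_closedBall α r).prod (isCompact_uIcc (a := 0) (b := θ)))
    |>.exists_bound_of_continuousOn (f := fun z : ℝ × ℝ => (w z.2 * s z.2) * n' (z.1 * s z.2)) (by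
      refine ContinuousOn.mul (by fun_prop) (hn'.comp (by fun_prop) ?_)
      rintro ⟨a, φ⟩ ⟨ha, -⟩
      exact mul_lt_of_mem_unit hb (hlt a ha) (hs0 φ) (hs1 φ))
  refine (intervalIntegral.hasDerivAt_integral_of_dominated_loc_of_deriv_le
    (F := fun a φ => w φ * n (a * s φ)) (F' := fun a φ => (w φ * s φ) * n' (a * s φ))
    (bound := fun _ => C) (s := Metric.closedBall α r) (Metric.closedBall_mem_nhds α hr)
    ?_ ?_ ?_ ?_ ?_ ?_).2
  · filter_upwards [Iio_mem_nhds hα] with a ha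
    exact (continuous_weighted_integrand hb hs hs0 hs1 hw hnc ha).aestronglyMeasurable
  · exact (continuous_weighted_integrand hb hs hs0 hs1 hw hnc hα).intervalIntegrable _ _
  · exact (continuous_weighted_integrand hb hs hs0 hs1 (hw.mul hs) hn' hα).aestronglyMeasurable
  · exact Eventually.of_forall fun φ hφ a ha => hC (a, φ) ⟨ha, Set.uIoc_subset_uIcc hφ⟩
  · exact intervalIntegrable_const
  · refine Eventually.of_forall fun φ _ a ha => ?_
    have h := ((hn _ (mul_lt_of_mem_unit hb (hlt a ha) (hs0 φ) (hs1 φ))).comp a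
      ((hasDerivAt_id a).mul_const (s φ))).const_mul (w φ)
    exact h.congr_deriv (by ring)

theorem hasDerivAt_weightedPrimitive_right (hb : 0 < b) (hs : Continuous s) (hs0 : ∀ φ, 0 ≤ s φ)
    (hs1 : ∀ φ, s φ ≤ 1) (hw : Continuous w) (hn : ContinuousOn n (Set.Iio b)) {α : ℝ}
    (hα : α < b) (θ : ℝ) :
    HasDerivAt (fun t => weightedPrimitive s w n α t) (w θ * n (α * s θ)) θ :=
  intervalIntegral.integral_hasDerivAt_right
    ((continuous_weighted_integrand hb hs hs0 hs1 hw hn hα).intervalIntegrable _ _)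
    ((continuous_weighted_integrand hb hs hs0 hs1 hw hn hα).stronglyMeasurableAtFilter _ _)
    (continuous_weighted_integrand hb hs hs0 hs1 hw hn hα).continuousAt

theorem isOpen_fst_lt (b : ℝ) : IsOpen {z : ℝ × ℝ | z.1 < b} :=
  isOpen_lt continuous_fst continuous_const

theorem continuousOn_weighted_integrand (hb : 0 < b) (hs : Continuous s) (hs0 : ∀ φ, 0 ≤ s φ)
    (hs1 : ∀ φ, s φ ≤ 1) (hw : Continuous w) (hn : ContinuousOn n (Set.Iio b)) :
    ContinuousOn (fun z : ℝ × ℝ => w z.2 * n (z.1 * s z.2)) {z | z.1 < b} :=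
  ContinuousOn.mul (by fun_prop) (hn.comp (by fun_prop)
    fun z hz => mul_lt_of_mem_unit hb hz (hs0 z.2) (hs1 z.2))

/-- The differential of `weightedPrimitive s w n`, when `n' ` is the derivative of `n`. -/
noncomputable def weightedPrimitiveFDeriv (s w n n' : ℝ → ℝ) (z : ℝ × ℝ) : ℝ × ℝ →L[ℝ] ℝ :=
  weightedPrimitive s (fun φ => w φ * s φ) n' z.1 z.2 • ContinuousLinearMap.fst ℝ ℝ ℝ +
    (w z.2 * n (z.1 * s z.2)) • ContinuousLinearMap.snd ℝ ℝ ℝ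

theorem hasFDerivAt_weightedPrimitive (hb : 0 < b) (hs : Continuous s) (hs0 : ∀ φ, 0 ≤ s φ)
    (hs1 : ∀ φ, s φ ≤ 1) (hw : Continuous w) (hn : ∀ v < b, HasDerivAt n (n' v) v)
    (hn' : ContinuousOn n' (Set.Iio b)) {z : ℝ × ℝ} (hz : z.1 < b) :
    HasFDerivAt (fun z : ℝ × ℝ => weightedPrimitive s w n z.1 z.2)
      (weightedPrimitiveFDeriv s w n n' z) z := by
  have hnc : ContinuousOn n (Set.Iio b) := fun v hv => (hn v hv).continuousAt.continuousWithinAt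
  have hnhds : {z : ℝ × ℝ | z.1 < b} ∈ 𝓝 z := (isOpen_fst_lt b).mem_nhds hz
  have key := hasStrictFDerivAt_uncurry_coprod (𝕜 := ℝ) (u := z) (f := weightedPrimitive s w n)
    (f₁ := fun a t => ContinuousLinearMap.toSpanSingleton ℝ
      (weightedPrimitive s (fun φ => w φ * s φ) n' a t))
    (f₂ := fun a t => ContinuousLinearMap.toSpanSingleton ℝ (w t * n (a * s t)))
    (by
      filter_upwards [hnhds] with y hy
      exact (hasDerivAt_weightedPrimitive_left hb hs hs0 hs1 hw hn hn' hy y.2).hasFDerivAt)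
    (by
      filter_upwards [hnhds] with y hy
      exact (hasDerivAt_weightedPrimitive_right hb hs hs0 hs1 hw hnc hy y.2).hasFDerivAt)
    (by
      have := (continuousOn_weightedPrimitive hb hs hs0 hs1 (hw.mul hs) hn').continuousAt hnhds
      exact (ContinuousLinearMap.toSpanSingletonCLE (𝕜 := ℝ) (E := ℝ)).continuous.continuousAt.comp
        this)
    (by
      have := (continuousOn_weighted_integrand hb hs hs0 hs1 hw hnc).continuousAt hnhds
      exact (ContinuousLinearMap.toSpanSingletonCLE (𝕜 := ℝ) (E := ℝ)).continuous.continuousAt.comp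
        this)
  refine key.hasFDerivAt.congr_fderiv ?_
  ext <;> simp [weightedPrimitiveFDeriv, Function.HasUncurry.uncurry]

theorem contDiffAt_weightedPrimitive (hb : 0 < b) (hs : Continuous s) (hs0 : ∀ φ, 0 ≤ s φ)
    (hs1 : ∀ φ, s φ ≤ 1) (hw : Continuous w) (hn : ∀ v < b, HasDerivAt n (n' v) v)
    (hn' : ContinuousOn n' (Set.Iio b)) {z : ℝ × ℝ} (hz : z.1 < b) :
    ContDiffAt ℝ 1 (fun z : ℝ × ℝ => weightedPrimitive s w n z.1 z.2) z := by
  have hnc : ContinuousOn n (Set.Iio b) := fun v hv => (hn v hv).continuousAt.continuousWithinAt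
  have hnhds : {z : ℝ × ℝ | z.1 < b} ∈ 𝓝 z := (isOpen_fst_lt b).mem_nhds hz
  rw [contDiffAt_one_iff]
  refine ⟨weightedPrimitiveFDeriv s w n n', _, hnhds, ?_,
    fun y hy => hasFDerivAt_weightedPrimitive hb hs hs0 hs1 hw hn hn' hy⟩
  exact ((continuousOn_weightedPrimitive hb hs hs0 hs1 (hw.mul hs) hn').smul
    continuousOn_const).add
    ((continuousOn_weighted_integrand hb hs hs0 hs1 hw hnc).smul continuousOn_const)

end weightedPrimitive

end CurlCurlWave

/-! ### The energy relation and the angular velocity along an orbit. -/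

namespace CurlCurlWave

/-- The coefficient `2/(p+1)` of the potential `y² - 2|y|^{p+1}/(p+1)`. -/
noncomputable def potCoeff (p : ℝ) : ℝ := 2 / (p + 1)

/-- In terms of `w = |y|^{p-1}`, the `(p-1)/2`-th power of the potential
`y² - 2|y|^{p+1}/(p+1)`. -/
noncomputable def potPow (p w : ℝ) : ℝ := w * (1 - potCoeff p * w) ^ ((p - 1) / 2)

/-- The value of `potPow p` at the saddle point `w = 1`. -/
noncomputable def potMax (p : ℝ) : ℝ := (1 - potCoeff p) ^ ((p - 1) / 2)

/-- The inverse of `potPow p` on `(-∞, 1)`. -/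
noncomputable def potInv (p : ℝ) : ℝ → ℝ := Function.invFunOn (potPow p) (Set.Iio 1)

/-- The ratio `z / sin θ` along an orbit. -/
noncomputable def orbitRatio (p v : ℝ) : ℝ := (√(1 - potCoeff p * potInv p v))⁻¹

/-- The inverse angular velocity `dt/dθ` along an orbit. -/
noncomputable def angleTime (p v : ℝ) : ℝ := √(1 - potCoeff p * potInv p v) / (1 - potInv p v)

/-- The quotient `(angleTime p v - 1) / v`. -/
noncomputable def angleTimeQuot (p v : ℝ) : ℝ :=
  orbitRatio p v ^ (p - 1) * (2 - potCoeff p - potInv p v) /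
    ((1 - potInv p v) ^ 2 * (1 + angleTime p v))

variable {p : ℝ}

theorem potCoeff_pos (hp : 1 < p) : 0 < potCoeff p := by unfold potCoeff; positivity

theorem potCoeff_lt_one (hp : 1 < p) : potCoeff p < 1 := by
  unfold potCoeff; rw [div_lt_one] <;> linarith

theorem potCoeff_mul (hp : 1 < p) : potCoeff p * (p + 1) = 2 := by
  unfold potCoeff; field_simp

theorem one_sub_potCoeff_mul_pos (hp : 1 < p) {w : ℝ} (hw : w ≤ 1) : 0 < 1 - potCoeff p * w := by
  nlinarith [potCoeff_pos hp, potCoeff_lt_one hp]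

theorem potMax_pos (hp : 1 < p) : 0 < potMax p :=
  Real.rpow_pos_of_pos (by linarith [potCoeff_lt_one hp]) _

theorem potPow_zero : potPow p 0 = 0 := by simp [potPow]

theorem potPow_one : potPow p 1 = potMax p := by simp [potPow, potMax]

/-- The relation `c (p + 1) = 2` collapses the product rule to a multiple of `1 - w`. The saddle `w
= 1` is thus the only critical point in `w ≤ 1`, and the inverse is smooth strictly below it. -/
theorem hasDerivAt_potPow (hp : 1 < p) {w : ℝ} (hw : w ≤ 1) :
    HasDerivAt (potPow p) ((1 - potCoeff p * w) ^ ((p - 3) / 2) * (1 - w)) w := by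
  have h0 := one_sub_potCoeff_mul_pos hp hw
  have h1 : HasDerivAt (fun w => 1 - potCoeff p * w) (-potCoeff p) w := by
    simpa using ((hasDerivAt_id w).const_mul (potCoeff p)).const_sub 1
  refine ((hasDerivAt_id w).mul (h1.rpow_const (p := (p - 1) / 2) (Or.inl h0.ne'))).congr_deriv ?_
  have h2 : (1 - potCoeff p * w) ^ ((p - 1) / 2) =
      (1 - potCoeff p * w) ^ ((p - 3) / 2) * (1 - potCoeff p * w) := by
    rw [← Real.rpow_add_one h0.ne']; congr 1; ring
  have h3 : (p - 1) / 2 - 1 = (p - 3) / 2 := by ring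
  rw [h2, h3]
  simp only [id]
  linear_combination (-(1 - potCoeff p * w) ^ ((p - 3) / 2) * w / 2) * potCoeff_mul hp

theorem contDiffAt_potPow (hp : 1 < p) {w : ℝ} (hw : w ≤ 1) {n : WithTop ℕ∞} :
    ContDiffAt ℝ n (potPow p) w :=
  contDiffAt_id.mul ((contDiffAt_const.sub (contDiffAt_const.mul contDiffAt_id)).rpow_const_of_ne
    (one_sub_potCoeff_mul_pos hp hw).ne')

theorem strictMonoOn_potPow (hp : 1 < p) : StrictMonoOn (potPow p) (Set.Iic 1) := by
  refine strictMonoOn_of_deriv_pos (convex_Iic 1)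
    (fun w hw => (hasDerivAt_potPow hp hw).continuousAt.continuousWithinAt) fun w hw => ?_
  rw [interior_Iic] at hw
  rw [(hasDerivAt_potPow hp (le_of_lt hw)).deriv]
  exact mul_pos (Real.rpow_pos_of_pos (one_sub_potCoeff_mul_pos hp (le_of_lt hw)) _)
    (sub_pos.2 hw)

theorem exists_potPow_eq (hp : 1 < p) {v : ℝ} (hv : v < potMax p) : ∃ w < 1, potPow p w = v := by
  -- Lower end for the intermediate value theorem: for `w ≤ 0` the power factor is at least `1`, so
  -- `potPow p w ≤ w`.
  have h1 : potPow p (min v 0) ≤ v := by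
    have h2 : 1 ≤ (1 - potCoeff p * min v 0) ^ ((p - 1) / 2) :=
      Real.one_le_rpow (by nlinarith [potCoeff_pos hp, min_le_right v 0]) (by linarith)
    unfold potPow
    nlinarith [min_le_right v 0, min_le_left v 0]
  have h3 : min v 0 ≤ 1 := (min_le_right _ _).trans zero_le_one
  obtain ⟨w, hw, hwv⟩ := intermediate_value_Icc h3 (f := potPow p)
    (fun w hw => (hasDerivAt_potPow hp hw.2).continuousAt.continuousWithinAt)
    ⟨h1, by rw [potPow_one]; exact hv.le⟩
  refine ⟨w, lt_of_le_of_ne hw.2 ?_, hwv⟩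
  rintro rfl
  rw [potPow_one] at hwv
  exact hv.ne' hwv

theorem potInv_lt_one (hp : 1 < p) {v : ℝ} (hv : v < potMax p) : potInv p v < 1 :=
  Function.invFunOn_mem (exists_potPow_eq hp hv)

theorem potPow_potInv (hp : 1 < p) {v : ℝ} (hv : v < potMax p) : potPow p (potInv p v) = v :=
  Function.invFunOn_eq (exists_potPow_eq hp hv)

theorem potPow_lt_potMax (hp : 1 < p) {w : ℝ} (hw : w < 1) : potPow p w < potMax p := by
  rw [← potPow_one]
  exact strictMonoOn_potPow hp (Set.mem_Iic.2 hw.le) (Set.mem_Iic.2 le_rfl) hw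

theorem potInv_potPow (hp : 1 < p) {w : ℝ} (hw : w < 1) : potInv p (potPow p w) = w :=
  (strictMonoOn_potPow hp).injOn (potInv_lt_one hp (potPow_lt_potMax hp hw)).le hw.le
    (potPow_potInv hp (potPow_lt_potMax hp hw))

theorem potInv_zero (hp : 1 < p) : potInv p 0 = 0 := by
  simpa [potPow_zero] using potInv_potPow hp zero_lt_one

theorem potInv_nonneg (hp : 1 < p) {v : ℝ} (h0 : 0 ≤ v) (hv : v < potMax p) : 0 ≤ potInv p v := by
  rw [← (strictMonoOn_potPow hp).le_iff_le (Set.mem_Iic.2 zero_le_one)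
    (Set.mem_Iic.2 (potInv_lt_one hp hv).le),
    potPow_potInv hp hv, potPow_zero]
  exact h0

/-- The derivative of `potInv p`, as a function of the value `w` of `potInv p`. -/
noncomputable def potInvDeriv (p w : ℝ) : ℝ :=
  ((1 - potCoeff p * w) ^ ((p - 3) / 2) * (1 - w))⁻¹

theorem potInvDeriv_pos (hp : 1 < p) {w : ℝ} (hw : w < 1) : 0 < potInvDeriv p w :=
  inv_pos.2 (mul_pos (Real.rpow_pos_of_pos (one_sub_potCoeff_mul_pos hp hw.le) _) (sub_pos.2 hw))

theorem contDiffAt_potInv (hp : 1 < p) {v : ℝ} (hv : v < potMax p) {n : WithTop ℕ∞} (hn : n ≠ 0) :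
    ContDiffAt ℝ n (potInv p) v := by
  have h1 := potInv_lt_one hp hv
  have h := (contDiffAt_potPow hp h1.le (n := n)).of_eventually_leftInverse_real
    (hasDerivAt_potPow hp h1.le) (inv_pos.1 (potInvDeriv_pos hp h1)).ne' hn (g := potInv p)
    (by filter_upwards [Iio_mem_nhds h1] with w hw using potInv_potPow hp hw)
  rwa [potPow_potInv hp hv] at h

theorem hasDerivAt_potInv (hp : 1 < p) {v : ℝ} (hv : v < potMax p) :
    HasDerivAt (potInv p) (potInvDeriv p (potInv p v)) v := by
  have h1 := potInv_lt_one hp hv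
  refine HasDerivAt.of_local_left_inverse (f := potPow p)
    (contDiffAt_potInv hp hv one_ne_zero).continuousAt (hasDerivAt_potPow hp h1.le)
    (inv_pos.1 (potInvDeriv_pos hp h1)).ne' ?_
  filter_upwards [Iio_mem_nhds hv] with u hu using potPow_potInv hp hu

theorem orbitRatio_pos (hp : 1 < p) {v : ℝ} (hv : v < potMax p) : 0 < orbitRatio p v :=
  inv_pos.2 (Real.sqrt_pos.2 (one_sub_potCoeff_mul_pos hp (potInv_lt_one hp hv).le))

theorem orbitRatio_le (hp : 1 < p) {v : ℝ} (hv : v < potMax p) :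
    orbitRatio p v ≤ (√(1 - potCoeff p))⁻¹ := by
  have := potCoeff_lt_one hp
  exact inv_anti₀ (Real.sqrt_pos.2 (by linarith))
    (Real.sqrt_le_sqrt (by nlinarith [potInv_lt_one hp hv, potCoeff_pos hp]))

theorem angleTime_pos (hp : 1 < p) {v : ℝ} (hv : v < potMax p) : 0 < angleTime p v :=
  div_pos (Real.sqrt_pos.2 (one_sub_potCoeff_mul_pos hp (potInv_lt_one hp hv).le))
    (sub_pos.2 (potInv_lt_one hp hv))

theorem contDiffAt_sqrt_potInv (hp : 1 < p) {v : ℝ} (hv : v < potMax p) :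
    ContDiffAt ℝ 2 (fun v => √(1 - potCoeff p * potInv p v)) v :=
  (contDiffAt_const.sub (contDiffAt_const.mul (contDiffAt_potInv hp hv two_ne_zero))).sqrt
    (one_sub_potCoeff_mul_pos hp (potInv_lt_one hp hv).le).ne'

theorem contDiffAt_orbitRatio (hp : 1 < p) {v : ℝ} (hv : v < potMax p) :
    ContDiffAt ℝ 2 (orbitRatio p) v :=
  (contDiffAt_sqrt_potInv hp hv).inv (inv_pos.1 (orbitRatio_pos hp hv)).ne'

theorem contDiffAt_angleTime (hp : 1 < p) {v : ℝ} (hv : v < potMax p) :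
    ContDiffAt ℝ 2 (angleTime p) v :=
  (contDiffAt_sqrt_potInv hp hv).div
    (contDiffAt_const.sub (contDiffAt_potInv hp hv two_ne_zero))
    (sub_pos.2 (potInv_lt_one hp hv)).ne'

theorem contDiffAt_angleTimeQuot (hp : 1 < p) {v : ℝ} (hv : v < potMax p) :
    ContDiffAt ℝ 2 (angleTimeQuot p) v := by
  have hW := contDiffAt_potInv hp hv two_ne_zero
  have h1 := sub_pos.2 (potInv_lt_one hp hv)
  have h2 := angleTime_pos hp hv
  exact (((contDiffAt_orbitRatio hp hv).rpow_const_of_ne (orbitRatio_pos hp hv).ne').mul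
    (contDiffAt_const.sub hW)).div (((contDiffAt_const.sub hW).pow 2).mul
      (contDiffAt_const.add (contDiffAt_angleTime hp hv))) (by positivity)

/-- The equation `potPow p w = v` solved for its linear factor; along an orbit it says that `α
|z|^{p-1}` is `potInv`. -/
theorem mul_orbitRatio_rpow (hp : 1 < p) {v : ℝ} (hv : v < potMax p) :
    v * orbitRatio p v ^ (p - 1) = potInv p v := by
  have h0 := one_sub_potCoeff_mul_pos hp (potInv_lt_one hp hv).le
  have h1 : orbitRatio p v ^ (p - 1) = ((1 - potCoeff p * potInv p v) ^ ((p - 1) / 2))⁻¹ := by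
    rw [orbitRatio, Real.inv_rpow (Real.sqrt_nonneg _), Real.sqrt_eq_rpow, ← Real.rpow_mul h0.le]
    congr 2; ring
  have h2 := potPow_potInv hp hv
  unfold potPow at h2
  have h3 := Real.rpow_pos_of_pos h0 ((p - 1) / 2)
  rw [h1, ← div_eq_mul_inv, div_eq_iff h3.ne', h2]

/-- Difference of squares: `angleTime² - 1 = w (2 - c - w) / (1 - w)²`, and the factor `w` equals
`v` times a power of `orbitRatio`. -/
theorem angleTime_eq (hp : 1 < p) {v : ℝ} (hv : v < potMax p) :
    angleTime p v = 1 + v * angleTimeQuot p v := by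
  have h0 := one_sub_potCoeff_mul_pos hp (potInv_lt_one hp hv).le
  have h1 := sub_pos.2 (potInv_lt_one hp hv)
  have h2 := angleTime_pos hp hv
  have h3 : angleTime p v ^ 2 * (1 - potInv p v) ^ 2 = 1 - potCoeff p * potInv p v := by
    rw [angleTime, div_pow, Real.sq_sqrt h0.le]
    field_simp
  rw [angleTimeQuot, ← mul_div_assoc, ← mul_assoc, mul_orbitRatio_rpow hp hv]
  field_simp
  linear_combination h3

theorem orbitRatio_mul {v : ℝ} :
    orbitRatio p v * (1 - potInv p v) = (angleTime p v)⁻¹ := by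
  rw [angleTime, orbitRatio, inv_div]; ring

theorem angleTimeQuot_pos (hp : 1 < p) {v : ℝ} (hv : v < potMax p) : 0 < angleTimeQuot p v := by
  have h1 := sub_pos.2 (potInv_lt_one hp hv)
  have h2 := angleTime_pos hp hv
  have h3 := Real.rpow_pos_of_pos (orbitRatio_pos hp hv) (p - 1)
  have h4 := potCoeff_lt_one hp
  have : 0 < 2 - potCoeff p - potInv p v := by linarith
  unfold angleTimeQuot
  positivity

/-- For `0 ≤ w < 1` the power of `orbitRatio` is at least `1`, the other numerator factor at least
`1 - c`, and the denominator at most `2`. This uniform bound is what later controls the amplitude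
for all `x`. -/
theorem le_angleTimeQuot (hp : 1 < p) {v : ℝ} (h0 : 0 ≤ v) (hv : v < potMax p) :
    (1 - potCoeff p) / 2 ≤ angleTimeQuot p v := by
  have h1 := sub_pos.2 (potInv_lt_one hp hv)
  have h2 := angleTime_pos hp hv
  have hW := potInv_nonneg hp h0 hv
  have hc := potCoeff_lt_one hp
  have hc0 := potCoeff_pos hp
  have hs : √(1 - potCoeff p * potInv p v) ≤ 1 := by
    rw [Real.sqrt_le_one]; nlinarith
  have h3 : 1 ≤ orbitRatio p v ^ (p - 1) := by
    refine Real.one_le_rpow ?_ (by linarith)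
    exact (one_le_inv₀ (inv_pos.1 (orbitRatio_pos hp hv))).2 hs
  have h4 : (1 - potInv p v) ^ 2 * (1 + angleTime p v) ≤ 2 := by
    have : (1 - potInv p v) ^ 2 * (1 + angleTime p v) =
        (1 - potInv p v) ^ 2 + (1 - potInv p v) * √(1 - potCoeff p * potInv p v) := by
      unfold angleTime; field_simp
    rw [this]
    nlinarith [Real.sqrt_nonneg (1 - potCoeff p * potInv p v)]
  unfold angleTimeQuot
  refine div_le_div₀ (by nlinarith) (by nlinarith) (by positivity) h4

theorem hasDerivAt_sqrt_potInv (hp : 1 < p) {v : ℝ} (hv : v < potMax p) :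
    HasDerivAt (fun v => √(1 - potCoeff p * potInv p v))
      (-(potCoeff p * potInvDeriv p (potInv p v)) / (2 * √(1 - potCoeff p * potInv p v))) v :=
  (((hasDerivAt_potInv hp hv).const_mul (potCoeff p)).const_sub 1).sqrt
    (one_sub_potCoeff_mul_pos hp (potInv_lt_one hp hv).le).ne'

/-- The sign is that of `1 - c (1 + w) / 2`, positive because `c < 1` and `w < 1`. Monotonicity of
the period in `α` comes from here. -/
theorem deriv_angleTime_pos (hp : 1 < p) {v : ℝ} (hv : v < potMax p) :
    0 < deriv (angleTime p) v := by
  have h0 := one_sub_potCoeff_mul_pos hp (potInv_lt_one hp hv).le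
  have h1 := sub_pos.2 (potInv_lt_one hp hv)
  have h2 := potInvDeriv_pos hp (potInv_lt_one hp hv)
  have h3 := Real.sqrt_pos.2 h0
  have h4 := Real.sq_sqrt h0.le
  have h := (hasDerivAt_sqrt_potInv hp hv).div ((hasDerivAt_potInv hp hv).const_sub 1) h1.ne'
  have h5 : deriv (angleTime p) v = _ := h.deriv
  rw [h5]
  refine div_pos ?_ (by positivity)
  set W := potInv p v
  set D := potInvDeriv p W
  set S := √(1 - potCoeff p * W)
  have h6 : -(potCoeff p * D) / (2 * S) * (1 - W) - S * -D =
      D * (S ^ 2 - potCoeff p * (1 - W) / 2) / S := by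
    field_simp; ring
  rw [h6]
  refine div_pos (mul_pos h2 ?_) h3
  rw [h4]
  nlinarith [potCoeff_pos hp, potCoeff_lt_one hp]

/-- The displacement `u H(α|u|^{p-1})` has derivative `angleTime`. -/
theorem hasDerivAt_mul_orbitRatio (hp : 1 < p) {α u : ℝ} (hv : α * |u| ^ (p - 1) < potMax p) :
    HasDerivAt (fun u => u * orbitRatio p (α * |u| ^ (p - 1)))
      (angleTime p (α * |u| ^ (p - 1))) u := by
  rcases eq_or_ne u 0 with rfl | hu
  · have hp1 : p - 1 ≠ 0 := by linarith
    simp only [abs_zero, Real.zero_rpow hp1, mul_zero] at hv ⊢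
    have h1 : angleTime p 0 = 1 := by simp [angleTime, potInv_zero hp]
    have h2 : orbitRatio p 0 = 1 := by simp [orbitRatio, potInv_zero hp]
    -- At `u = 0` the chain rule is unavailable, as `|u|^(p-1)` need not be differentiable there
    -- when `p ≤ 2`. The difference quotient, however, is `orbitRatio` itself, which tends to `1`.
    rw [h1, hasDerivAt_iff_tendsto_slope]
    have h3 : Tendsto (fun u : ℝ => orbitRatio p (α * |u| ^ (p - 1))) (𝓝[≠] 0) (𝓝 1) := by
      have hc : ContinuousAt (fun u : ℝ => orbitRatio p (α * |u| ^ (p - 1))) 0 := by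
        refine ContinuousAt.comp (g := orbitRatio p) ?_ ?_
        · simpa [Real.zero_rpow hp1] using (contDiffAt_orbitRatio hp hv).continuousAt
        · exact (continuous_const.mul
            (continuous_abs.rpow_const fun _ => Or.inr (by linarith))).continuousAt
      have := hc.tendsto
      simp only [abs_zero, Real.zero_rpow hp1, mul_zero, h2] at this
      exact this.mono_left nhdsWithin_le_nhds
    refine h3.congr' ?_
    filter_upwards [self_mem_nhdsWithin] with u hu
    have hu : u ≠ 0 := hu
    simp [slope_def_field]
    field_simp
  · have hW1 := potInv_lt_one hp hv
    have habs : HasDerivAt (fun u : ℝ => |u| ^ (p - 1)) ((p - 1) * |u| ^ (p - 1) / u) u := by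
      refine ((hasDerivAt_abs hu).rpow_const (p := p - 1) (Or.inl (abs_ne_zero.2 hu))).congr_deriv ?_
      rw [Real.rpow_sub_one (abs_ne_zero.2 hu) (p - 1)]
      rcases hu.lt_or_gt with h | h
      · simp [abs_of_neg h, sign_neg h]; field_simp; ring
      · simp [abs_of_pos h, sign_pos h]; field_simp
    set v := α * |u| ^ (p - 1) with hvdef
    have h0 := one_sub_potCoeff_mul_pos hp hW1.le
    have h1 := sub_pos.2 hW1
    have h3 := Real.sqrt_pos.2 h0
    have h4 := Real.sq_sqrt h0.le
    have hr : HasDerivAt (orbitRatio p) _ v := (hasDerivAt_sqrt_potInv hp hv).inv h3.ne'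
    have hcomp := (hasDerivAt_id u).mul (HasDerivAt.comp u (h₂ := orbitRatio p) hr
      (habs.const_mul α))
    refine hcomp.congr_deriv ?_
    -- The logarithmic derivative of `potPow p w = v`, freed of fractional powers.
    have h5 : v * potInvDeriv p (potInv p v) * (1 - potInv p v) =
        potInv p v * (1 - potCoeff p * potInv p v) := by
      have h6 := potPow_potInv hp hv
      have h7 : (1 - potCoeff p * potInv p v) ^ ((p - 1) / 2) =
          (1 - potCoeff p * potInv p v) ^ ((p - 3) / 2) * (1 - potCoeff p * potInv p v) := by
        rw [← Real.rpow_add_one h0.ne']; congr 1; ring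
      have h8 := Real.rpow_pos_of_pos h0 ((p - 3) / 2)
      rw [potPow, h7] at h6
      nth_rewrite 1 [← h6]
      rw [potInvDeriv]
      generalize (1 - potCoeff p * potInv p v) ^ ((p - 3) / 2) = A at h8
      field_simp
    simp only [id, Function.comp_def, orbitRatio, angleTime]
    rw [← hvdef]
    have h9 : α * ((p - 1) * |u| ^ (p - 1) / u) = (p - 1) * v / u := by rw [hvdef]; ring
    rw [h9]
    set W := potInv p v
    set D := potInvDeriv p W
    set S := √(1 - potCoeff p * W)
    field_simp
    have hc := potCoeff_mul hp
    linear_combination (potCoeff p * (p - 1)) * h5 +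
      (2 * (1 - W) - 2 * (S ^ 2 + 1 - potCoeff p * W)) * h4 + (1 - potCoeff p * W) * W * hc
end CurlCurlWave

/-! ### The period as a function of the orbit parameter. -/

namespace CurlCurlWave

section
variable {n : ℝ → ℝ} {b : ℝ}

theorem hasDerivAt_of_contDiffAt_two (hn : ∀ v < b, ContDiffAt ℝ 2 n v) :
    ∀ v < b, HasDerivAt n (deriv n v) v := fun v hv =>
  ((hn v hv).differentiableAt two_ne_zero).hasDerivAt

theorem contDiffOn_deriv_of_contDiffAt_two (hn : ∀ v < b, ContDiffAt ℝ 2 n v) :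
    ContDiffOn ℝ 1 (deriv n) (Set.Iio b) := by
  have h : ContDiffOn ℝ (1 + 1) n (Set.Iio b) := fun v hv => by
    rw [one_add_one_eq_two]; exact (hn v hv).contDiffWithinAt
  exact ((contDiffOn_succ_iff_deriv_of_isOpen isOpen_Iio).1 h).2.2

theorem hasDerivAt_deriv_of_contDiffAt_two (hn : ∀ v < b, ContDiffAt ℝ 2 n v) :
    ∀ v < b, HasDerivAt (deriv n) (deriv (deriv n) v) v := fun _ hv =>
  (((contDiffOn_deriv_of_contDiffAt_two hn).differentiableOn one_ne_zero).differentiableAt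
    (Iio_mem_nhds hv)).hasDerivAt

theorem continuousOn_deriv_deriv_of_contDiffAt_two (hn : ∀ v < b, ContDiffAt ℝ 2 n v) :
    ContinuousOn (deriv (deriv n)) (Set.Iio b) :=
  ((contDiffOn_deriv_of_contDiffAt_two hn).continuousOn_deriv_of_isOpen isOpen_Iio le_rfl)

theorem contDiffOn_weightedPrimitive_left {s w : ℝ → ℝ} (hb : 0 < b) (hs : Continuous s)
    (hs0 : ∀ φ, 0 ≤ s φ) (hs1 : ∀ φ, s φ ≤ 1) (hw : Continuous w)
    (hn : ∀ v < b, ContDiffAt ℝ 2 n v) (θ : ℝ) :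
    ContDiffOn ℝ 2 (fun a => weightedPrimitive s w n a θ) (Set.Iio b) := by
  have hd : ∀ a < b, HasDerivAt (fun a => weightedPrimitive s w n a θ) _ a := fun a ha =>
    hasDerivAt_weightedPrimitive_left hb hs hs0 hs1 hw (hasDerivAt_of_contDiffAt_two hn)
      (contDiffOn_deriv_of_contDiffAt_two hn).continuousOn ha θ
  rw [← one_add_one_eq_two, contDiffOn_succ_iff_deriv_of_isOpen isOpen_Iio]
  refine ⟨fun a ha => (hd a ha).differentiableAt.differentiableWithinAt, by simp, ?_⟩
  refine ContDiffOn.congr (f := fun a => weightedPrimitive s (fun φ => w φ * s φ) (deriv n) a θ)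
    (fun a ha => ?_) fun a ha => (hd a ha).deriv
  exact ((contDiffAt_weightedPrimitive (z := (a, θ)) hb hs hs0 hs1 (hw.mul hs)
    (hasDerivAt_deriv_of_contDiffAt_two hn) (continuousOn_deriv_deriv_of_contDiffAt_two hn)
    ha).comp a (contDiffAt_id.prodMk contDiffAt_const)).contDiffWithinAt

end

/-- The weight `|sin φ|^{p-1}`. -/
noncomputable def sinPow (p φ : ℝ) : ℝ := |Real.sin φ| ^ (p - 1)

/-- The time needed to reach the angle `θ` on the orbit with parameter `α`. -/
noncomputable def orbitTime (p : ℝ) : ℝ → ℝ → ℝ :=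
  weightedPrimitive (sinPow p) (fun _ => 1) (angleTime p)

/-- The period of the orbit with parameter `α`. -/
noncomputable def orbitPeriod (p α : ℝ) : ℝ := orbitTime p α (2 * Real.pi)

/-- The quotient `(orbitPeriod p α - 2π) / α`. -/
noncomputable def periodQuot (p α : ℝ) : ℝ :=
  weightedPrimitive (sinPow p) (sinPow p) (angleTimeQuot p) α (2 * Real.pi)

variable {p : ℝ}

theorem continuous_sinPow (hp : 1 < p) : Continuous (sinPow p) :=
  (continuous_abs.comp Real.continuous_sin).rpow_const fun _ => Or.inr (by linarith)

theorem sinPow_nonneg (φ : ℝ) : 0 ≤ sinPow p φ := Real.rpow_nonneg (abs_nonneg _) _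

theorem sinPow_le_one (hp : 1 < p) (φ : ℝ) : sinPow p φ ≤ 1 :=
  Real.rpow_le_one (abs_nonneg _) (Real.abs_sin_le_one φ) (by linarith)

theorem mul_sinPow_lt (hp : 1 < p) {α : ℝ} (hα : α < potMax p) (φ : ℝ) :
    α * sinPow p φ < potMax p :=
  mul_lt_of_mem_unit (potMax_pos hp) hα (sinPow_nonneg φ) (sinPow_le_one hp φ)

theorem continuousOn_angleTime (hp : 1 < p) : ContinuousOn (angleTime p) (Set.Iio (potMax p)) :=
  fun _ hv => (contDiffAt_angleTime hp hv).continuousAt.continuousWithinAt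

theorem continuous_angleTime_comp (hp : 1 < p) {α : ℝ} (hα : α < potMax p) :
    Continuous fun φ => angleTime p (α * sinPow p φ) :=
  (continuousOn_angleTime hp).comp_continuous (continuous_const.mul (continuous_sinPow hp))
    (mul_sinPow_lt hp hα)

theorem hasDerivAt_orbitTime (hp : 1 < p) {α : ℝ} (hα : α < potMax p) (θ : ℝ) :
    HasDerivAt (orbitTime p α) (angleTime p (α * sinPow p θ)) θ := by
  have h := hasDerivAt_weightedPrimitive_right (potMax_pos hp) (continuous_sinPow hp)
    sinPow_nonneg (sinPow_le_one hp) continuous_const (continuousOn_angleTime hp) hα θ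
    (w := fun _ => 1)
  rw [one_mul] at h
  exact h

theorem orbitTime_zero (α : ℝ) : orbitTime p α 0 = 0 := by simp [orbitTime, weightedPrimitive]

theorem strictMono_orbitTime (hp : 1 < p) {α : ℝ} (hα : α < potMax p) :
    StrictMono (orbitTime p α) :=
  strictMono_of_deriv_pos fun θ => by
    rw [(hasDerivAt_orbitTime hp hα θ).deriv]
    exact angleTime_pos hp (mul_sinPow_lt hp hα θ)

theorem monotoneOn_angleTime (hp : 1 < p) : MonotoneOn (angleTime p) (Set.Iio (potMax p)) :=
  (strictMonoOn_of_deriv_pos (convex_Iio _) (continuousOn_angleTime hp) fun v hv => by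
    rw [interior_Iio] at hv
    exact deriv_angleTime_pos hp hv).monotoneOn

/-- `angleTime` is increasing and its argument stays above `min α 0`, so time grows at least
linearly in the angle, in both directions. -/
theorem surjective_orbitTime (hp : 1 < p) {α : ℝ} (hα : α < potMax p) :
    Function.Surjective (orbitTime p α) := by
  have hα' : min α 0 < potMax p := (min_le_left _ _).trans_lt hα
  have hm := angleTime_pos hp hα'
  set m := angleTime p (min α 0)
  have hle : ∀ θ, m ≤ angleTime p (α * sinPow p θ) := fun θ => by
    refine monotoneOn_angleTime hp hα' (mul_sinPow_lt hp hα θ) ?_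
    have h0 := sinPow_nonneg (p := p) θ
    have h1 := sinPow_le_one hp θ
    rcases le_or_gt α 0 with h | h
    · exact (min_le_left _ _).trans (by nlinarith)
    · exact (min_le_right _ _).trans (by positivity)
  have hmono : Monotone fun θ => orbitTime p α θ - m * θ := by
    have hd : ∀ θ, HasDerivAt (fun θ => orbitTime p α θ - m * θ) _ θ := fun θ =>
      (hasDerivAt_orbitTime hp hα θ).sub ((hasDerivAt_id θ).const_mul m)
    refine monotone_of_deriv_nonneg (fun θ => (hd θ).differentiableAt) fun θ => ?_
    rw [(hd θ).deriv]
    linarith [hle θ]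
  have hz : orbitTime p α 0 - m * 0 = 0 := by rw [orbitTime_zero]; simp
  refine Continuous.surjective
    (continuous_iff_continuousAt.2 fun θ => (hasDerivAt_orbitTime hp hα θ).continuousAt) ?_ ?_
  · refine tendsto_atTop_mono' _ ?_ (tendsto_id.const_mul_atTop hm)
    filter_upwards [eventually_ge_atTop 0] with θ hθ
    have := hmono hθ
    simp only [hz, id] at this ⊢
    linarith
  · refine tendsto_atBot_mono' _ ?_ (tendsto_id.const_mul_atBot hm)
    filter_upwards [eventually_le_atBot 0] with θ hθ
    have := hmono hθ
    simp only [hz, id] at this ⊢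
    linarith

theorem orbitPeriod_eq (hp : 1 < p) {α : ℝ} (hα : α < potMax p) :
    orbitPeriod p α = 2 * Real.pi + α * periodQuot p α := by
  have hc : ContinuousOn (angleTimeQuot p) (Set.Iio (potMax p)) :=
    fun _ hv => (contDiffAt_angleTimeQuot hp hv).continuousAt.continuousWithinAt
  have h1 := continuous_weighted_integrand (potMax_pos hp) (continuous_sinPow hp) sinPow_nonneg
    (sinPow_le_one hp) (continuous_sinPow hp) hc hα
  unfold orbitPeriod orbitTime periodQuot weightedPrimitive
  rw [← intervalIntegral.integral_const_mul]
  have h2 : ∫ _ in (0 : ℝ)..2 * Real.pi, (1 : ℝ) = 2 * Real.pi := by simp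
  have h3 := intervalIntegral.integral_add (μ := MeasureTheory.volume) (a := 0) (b := 2 * Real.pi)
    (f := fun _ => (1 : ℝ)) intervalIntegrable_const
    ((continuous_const (y := α)).mul h1 |>.intervalIntegrable _ _)
  rw [h2] at h3
  refine Eq.trans ?_ h3
  refine intervalIntegral.integral_congr fun φ _ => ?_
  simp only [one_mul, Pi.mul_apply]
  rw [angleTime_eq hp (mul_sinPow_lt hp hα φ)]
  ring

theorem contDiffAt_orbitPeriod (hp : 1 < p) {α : ℝ} (hα : α < potMax p) :
    ContDiffAt ℝ 2 (orbitPeriod p) α :=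
  (contDiffOn_weightedPrimitive_left (potMax_pos hp) (continuous_sinPow hp) sinPow_nonneg
    (sinPow_le_one hp) continuous_const (fun _ hv => contDiffAt_angleTime hp hv)
    _).contDiffAt (Iio_mem_nhds hα)

theorem contDiffAt_periodQuot (hp : 1 < p) {α : ℝ} (hα : α < potMax p) :
    ContDiffAt ℝ 2 (periodQuot p) α :=
  (contDiffOn_weightedPrimitive_left (potMax_pos hp) (continuous_sinPow hp) sinPow_nonneg
    (sinPow_le_one hp) (continuous_sinPow hp) (fun _ hv => contDiffAt_angleTimeQuot hp hv)
    _).contDiffAt (Iio_mem_nhds hα)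

theorem sinPow_pi_div_two : sinPow p (Real.pi / 2) = 1 := by simp [sinPow]

theorem integral_sinPow_pos (hp : 1 < p) : 0 < ∫ φ in (0 : ℝ)..2 * Real.pi, sinPow p φ :=
  intervalIntegral.integral_pos (by positivity) (continuous_sinPow hp).continuousOn
    (fun φ _ => sinPow_nonneg φ)
    ⟨Real.pi / 2, ⟨by positivity, by linarith [Real.pi_pos]⟩, by rw [sinPow_pi_div_two]; simp⟩

/-- The integrand of the `α`-derivative is nonnegative, and positive at `φ = π/2`. Positivity holds
at `α = 0` too, so the period map is invertible with `C²` inverse there. -/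
theorem deriv_orbitPeriod_pos (hp : 1 < p) {α : ℝ} (hα : α < potMax p) :
    0 < deriv (orbitPeriod p) α := by
  have hn : ∀ v < potMax p, ContDiffAt ℝ 2 (angleTime p) v :=
    fun _ hv => contDiffAt_angleTime hp hv
  have hc := (contDiffOn_deriv_of_contDiffAt_two hn).continuousOn
  have hd : HasDerivAt (orbitPeriod p) _ α := hasDerivAt_weightedPrimitive_left (potMax_pos hp)
    (continuous_sinPow hp) sinPow_nonneg (sinPow_le_one hp) continuous_const
    (hasDerivAt_of_contDiffAt_two hn) hc hα (2 * Real.pi)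
  rw [hd.deriv]
  refine intervalIntegral.integral_pos (by positivity) (continuous_weighted_integrand
    (potMax_pos hp) (continuous_sinPow hp) sinPow_nonneg (sinPow_le_one hp)
    (continuous_const.mul (continuous_sinPow hp)) hc hα).continuousOn
    (fun φ _ => mul_nonneg (by simpa using sinPow_nonneg φ)
      (deriv_angleTime_pos hp (mul_sinPow_lt hp hα φ)).le)
    ⟨Real.pi / 2, ⟨by positivity, by linarith [Real.pi_pos]⟩, ?_⟩
  simpa [sinPow_pi_div_two] using deriv_angleTime_pos hp hα

theorem strictMonoOn_orbitPeriod (hp : 1 < p) :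
    StrictMonoOn (orbitPeriod p) (Set.Iio (potMax p)) :=
  strictMonoOn_of_deriv_pos (convex_Iio _)
    (fun _ h => (contDiffAt_orbitPeriod hp h).continuousAt.continuousWithinAt) fun v hv => by
    rw [interior_Iio] at hv
    exact deriv_orbitPeriod_pos hp hv

theorem periodQuot_pos (hp : 1 < p) {α : ℝ} (hα : α < potMax p) : 0 < periodQuot p α := by
  have hc : ContinuousOn (angleTimeQuot p) (Set.Iio (potMax p)) :=
    fun _ hv => (contDiffAt_angleTimeQuot hp hv).continuousAt.continuousWithinAt
  refine intervalIntegral.integral_pos (by positivity) (continuous_weighted_integrand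
    (potMax_pos hp) (continuous_sinPow hp) sinPow_nonneg (sinPow_le_one hp)
    (continuous_sinPow hp) hc hα).continuousOn
    (fun φ _ => mul_nonneg (sinPow_nonneg φ) (angleTimeQuot_pos hp (mul_sinPow_lt hp hα φ)).le)
    ⟨Real.pi / 2, ⟨by positivity, by linarith [Real.pi_pos]⟩, ?_⟩
  rw [sinPow_pi_div_two]
  simpa using angleTimeQuot_pos hp hα

theorem le_periodQuot (hp : 1 < p) {α : ℝ} (h0 : 0 ≤ α) (hα : α < potMax p) :
    (1 - potCoeff p) / 2 * ∫ φ in (0 : ℝ)..2 * Real.pi, sinPow p φ ≤ periodQuot p α := by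
  have hc : ContinuousOn (angleTimeQuot p) (Set.Iio (potMax p)) :=
    fun _ hv => (contDiffAt_angleTimeQuot hp hv).continuousAt.continuousWithinAt
  unfold periodQuot weightedPrimitive
  rw [← intervalIntegral.integral_const_mul]
  refine intervalIntegral.integral_mono_on (by positivity)
    ((continuous_const.mul (continuous_sinPow hp)).intervalIntegrable _ _)
    ((continuous_weighted_integrand
    (potMax_pos hp) (continuous_sinPow hp) sinPow_nonneg (sinPow_le_one hp)
    (continuous_sinPow hp) hc hα).intervalIntegrable _ _) fun φ _ => ?_
  rw [mul_comm]
  exact mul_le_mul_of_nonneg_left (le_angleTimeQuot hp (mul_nonneg h0 (sinPow_nonneg φ))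
    (mul_sinPow_lt hp hα φ)) (sinPow_nonneg φ)

/-- Near the saddle the inverse angular velocity blows up like `(potMax p - v)^{-1/2}`. -/
theorem exists_le_angleTime (hp : 1 < p) : ∃ κ > 0, ∀ v, 0 ≤ v → v < potMax p → ∀ r > 0,
    potMax p - v ≤ r ^ 2 → κ / r ≤ angleTime p v := by
  have hc0 := potCoeff_pos hp
  have hc1 := potCoeff_lt_one hp
  have hc : 0 < 1 - potCoeff p := by linarith
  -- `2k` bounds `(1 - c w)^((p-3)/2)` below on `[0, 1]`: its minimum sits at `w = 1` or at `w = 0`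
  -- according to the sign of `p - 3`.
  set k := min 1 ((1 - potCoeff p) ^ ((p - 3) / 2)) / 2
  have hk : 0 < k := by
    have := Real.rpow_pos_of_pos hc ((p - 3) / 2)
    positivity
  have hpow : ∀ w ∈ Set.Icc (0 : ℝ) 1, 2 * k ≤ (1 - potCoeff p * w) ^ ((p - 3) / 2) := by
    intro w hw
    have hw0 := one_sub_potCoeff_mul_pos hp hw.2
    have : 2 * k = min 1 ((1 - potCoeff p) ^ ((p - 3) / 2)) := by simp only [k]; ring
    rw [this]
    rcases le_or_gt 0 ((p - 3) / 2) with h | h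
    · exact (min_le_right _ _).trans (Real.rpow_le_rpow hc.le (by nlinarith [hw.2]) h)
    · refine (min_le_left _ _).trans (Real.one_le_rpow_of_pos_of_le_one_of_nonpos hw0 ?_ h.le)
      nlinarith [hw.1]
  -- Comparison of derivatives, with equality at `w = 1`, gives the quadratic gap `potMax p - potPow
  -- p w ≥ k (1 - w)²` at the saddle.
  have hanti : AntitoneOn (fun w => potMax p - potPow p w - k * (1 - w) ^ 2) (Set.Icc 0 1) := by
    have hd : ∀ w ≤ 1, HasDerivAt (fun w => potMax p - potPow p w - k * (1 - w) ^ 2)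
        ((1 - w) * (2 * k - (1 - potCoeff p * w) ^ ((p - 3) / 2))) w := fun w hw => by
      refine (((hasDerivAt_potPow hp hw).const_sub (potMax p)).sub
        ((((hasDerivAt_id w).const_sub 1).pow 2).const_mul k)).congr_deriv ?_
      simp; ring
    refine antitoneOn_of_deriv_nonpos (convex_Icc 0 1)
      (fun w hw => (hd w hw.2).continuousAt.continuousWithinAt)
      (fun w hw => ?_) fun w hw => ?_
    · rw [interior_Icc] at hw
      exact (hd w hw.2.le).differentiableAt.differentiableWithinAt
    · rw [interior_Icc] at hw
      rw [(hd w hw.2.le).deriv]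
      nlinarith [hpow w ⟨hw.1.le, hw.2.le⟩, hw.2]
  refine ⟨√(1 - potCoeff p) * √k, by positivity, fun v hv0 hv r hr hvr => ?_⟩
  have hW1 := potInv_lt_one hp hv
  have hW0 := potInv_nonneg hp hv0 hv
  have h1 := hanti ⟨hW0, hW1.le⟩ ⟨zero_le_one, le_rfl⟩ hW1.le
  simp only [potPow_one, potPow_potInv hp hv] at h1
  have h2 : √k * (1 - potInv p v) ≤ r := by
    refine abs_le_of_sq_le_sq' ?_ hr.le |>.2
    rw [mul_pow, Real.sq_sqrt hk.le]
    linarith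
  have h3 : √(1 - potCoeff p) ≤ √(1 - potCoeff p * potInv p v) :=
    Real.sqrt_le_sqrt (by nlinarith)
  rw [angleTime, div_le_div_iff₀ hr (sub_pos.2 hW1), mul_assoc]
  exact mul_le_mul h3 h2 (mul_nonneg (Real.sqrt_nonneg _) (sub_pos.2 hW1).le) (Real.sqrt_nonneg _)

/-- For `q ≤ 1` one has `t ≤ t^q`; for `q > 1` this is Bernoulli's inequality. For `q = p - 1` the
constant `1 + q` is `p`. -/
theorem one_sub_rpow_le {q t : ℝ} (hq : 0 < q) (h0 : 0 ≤ t) (h1 : t ≤ 1) :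
    1 - t ^ q ≤ (1 + q) * (1 - t) := by
  rcases le_or_gt q 1 with h | h
  · have : t ≤ t ^ q := Real.self_le_rpow_of_le_one h0 h1 h
    nlinarith
  · have := one_add_mul_self_le_rpow_one_add (s := t - 1) (by linarith) h.le
    rw [add_sub_cancel] at this
    nlinarith

/-- An orbit close to the saddle lingers near `φ = π/2`. For `α = potMax p - η²` the integrand there
is at least `κ / (η + β (φ - π/2))`, whose integral diverges logarithmically as `η → 0`. -/
theorem exists_le_orbitPeriod (hp : 1 < p) (M : ℝ) :
    ∃ α, 0 ≤ α ∧ α < potMax p ∧ M ≤ orbitPeriod p α := by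
  obtain ⟨κ, hκ, hN⟩ := exists_le_angleTime hp
  have hb := potMax_pos hp
  set b := potMax p
  -- Chosen so that `β² (φ - π/2)²` absorbs the quadratic loss `b p (φ - π/2)² / 2` of `b |sin
  -- φ|^{p-1}` at its maximum.
  set β := √(b * p / 2)
  have hβ : 0 < β := Real.sqrt_pos.2 (by positivity)
  have hβ2 : β ^ 2 = b * p / 2 := Real.sq_sqrt (by positivity)
  -- The first bound ensures `α ≥ 0`, the second makes `(κ/β) log ((η + β)/η)` at least `M`.
  set η := min (√b) (β * Real.exp (-(M * β / κ)))
  have hη : 0 < η := by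
    have := Real.sqrt_pos.2 hb
    positivity
  have hηb : η ^ 2 ≤ b := by
    have h : η ≤ √b := min_le_left _ _
    calc η ^ 2 ≤ √b ^ 2 := by gcongr
      _ = b := Real.sq_sqrt hb.le
  have hα : b - η ^ 2 < b := by nlinarith
  refine ⟨b - η ^ 2, by linarith, hα, ?_⟩
  have hpos : ∀ φ ∈ Set.Icc (Real.pi / 2) (Real.pi / 2 + 1), 0 < η + β * (φ - Real.pi / 2) :=
    fun φ hφ => by nlinarith [hφ.1]
  have hbound : ∀ φ ∈ Set.Icc (Real.pi / 2) (Real.pi / 2 + 1),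
      κ / (η + β * (φ - Real.pi / 2)) ≤ angleTime p ((b - η ^ 2) * sinPow p φ) := by
    intro φ hφ
    refine hN _ (mul_nonneg (by linarith) (sinPow_nonneg φ)) (mul_sinPow_lt hp hα φ) _
      (hpos φ hφ) ?_
    have hcos : |Real.sin φ| ≥ 1 - (φ - Real.pi / 2) ^ 2 / 2 := by
      have h := Real.one_sub_sq_div_two_le_cos (x := φ - Real.pi / 2)
      rw [Real.cos_sub_pi_div_two] at h
      exact h.trans (le_abs_self _)
    have h1 := one_sub_rpow_le (q := p - 1) (by linarith) (abs_nonneg _) (Real.abs_sin_le_one φ)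
    have h2 : 1 - sinPow p φ ≤ p * (φ - Real.pi / 2) ^ 2 / 2 := by
      unfold sinPow; nlinarith
    have h3 := sinPow_le_one hp φ
    have h4 : b * (1 - sinPow p φ) ≤ b * (p * (φ - Real.pi / 2) ^ 2 / 2) := by gcongr
    have h5 : 0 ≤ 2 * η * β * (φ - Real.pi / 2) :=
      mul_nonneg (by positivity) (sub_nonneg.2 hφ.1)
    calc b - (b - η ^ 2) * sinPow p φ = b * (1 - sinPow p φ) + η ^ 2 * sinPow p φ := by ring
      _ ≤ b * (p * (φ - Real.pi / 2) ^ 2 / 2) + η ^ 2 := by nlinarith [sq_nonneg η]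
      _ = β ^ 2 * (φ - Real.pi / 2) ^ 2 + η ^ 2 := by rw [hβ2]; ring
      _ ≤ (η + β * (φ - Real.pi / 2)) ^ 2 := by nlinarith
  have hle : Real.pi / 2 ≤ Real.pi / 2 + 1 := by linarith
  have hcont := continuous_angleTime_comp hp hα
  have hFTC : ∫ φ in Real.pi / 2..Real.pi / 2 + 1, κ / (η + β * (φ - Real.pi / 2)) =
      κ / β * Real.log (η + β * (Real.pi / 2 + 1 - Real.pi / 2)) -
        κ / β * Real.log (η + β * (Real.pi / 2 - Real.pi / 2)) := by
    refine intervalIntegral.integral_eq_sub_of_hasDerivAt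
      (f := fun φ => κ / β * Real.log (η + β * (φ - Real.pi / 2))) (fun φ hφ => ?_) ?_
    · rw [Set.uIcc_of_le hle] at hφ
      refine (((((hasDerivAt_id φ).sub_const (Real.pi / 2)).const_mul β).const_add η).log
        (hpos φ hφ).ne' |>.const_mul (κ / β)).congr_deriv ?_
      have := (hpos φ hφ).ne'
      simp only [id]
      field_simp
    · refine ContinuousOn.intervalIntegrable ?_
      rw [Set.uIcc_of_le hle]
      exact continuousOn_const.div (by fun_prop) fun φ hφ => (hpos φ hφ).ne'
  have hlog : M * β / κ ≤ Real.log ((η + β) / η) := by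
    rw [Real.le_log_iff_exp_le (by positivity), le_div_iff₀ hη]
    have h : η ≤ β * Real.exp (-(M * β / κ)) := min_le_right _ _
    calc Real.exp (M * β / κ) * η ≤ Real.exp (M * β / κ) * (β * Real.exp (-(M * β / κ))) := by
          gcongr
      _ = β := by rw [Real.exp_neg]; field_simp
      _ ≤ η + β := by linarith
  calc M = κ / β * (M * β / κ) := by field_simp
    _ ≤ κ / β * Real.log ((η + β) / η) := by gcongr
    _ = ∫ φ in Real.pi / 2..Real.pi / 2 + 1, κ / (η + β * (φ - Real.pi / 2)) := by
      rw [hFTC, Real.log_div (by positivity) hη.ne']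
      simp; ring
    _ ≤ ∫ φ in Real.pi / 2..Real.pi / 2 + 1, angleTime p ((b - η ^ 2) * sinPow p φ) := by
      refine intervalIntegral.integral_mono_on hle ?_ (hcont.intervalIntegrable _ _) hbound
      refine ContinuousOn.intervalIntegrable ?_
      rw [Set.uIcc_of_le hle]
      exact continuousOn_const.div (by fun_prop) fun φ hφ => (hpos φ hφ).ne'
    _ ≤ ∫ φ in (0 : ℝ)..2 * Real.pi, angleTime p ((b - η ^ 2) * sinPow p φ) := by
      refine intervalIntegral.integral_mono_interval (by positivity) hle
        (by linarith [Real.pi_gt_three]) ?_ (hcont.intervalIntegrable _ _)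
      exact Eventually.of_forall fun φ => (angleTime_pos hp (mul_sinPow_lt hp hα φ)).le
    _ = orbitPeriod p (b - η ^ 2) := by simp [orbitPeriod, orbitTime, weightedPrimitive]

theorem orbitPeriod_zero (hp : 1 < p) : orbitPeriod p 0 = 2 * Real.pi := by
  simpa using orbitPeriod_eq hp (potMax_pos hp)

theorem exists_orbitPeriod_eq (hp : 1 < p) {e : ℝ} (he : 0 ≤ e) :
    ∃ α, 0 ≤ α ∧ α < potMax p ∧ orbitPeriod p α = 2 * Real.pi + e := by
  obtain ⟨β, hβ0, hβ, hle⟩ := exists_le_orbitPeriod hp (2 * Real.pi + e)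
  obtain ⟨α, hα, h⟩ := intermediate_value_Icc hβ0 (f := orbitPeriod p)
    (fun α hα => (contDiffAt_orbitPeriod hp (hα.2.trans_lt hβ)).continuousAt.continuousWithinAt)
    ⟨by rw [orbitPeriod_zero hp]; linarith, hle⟩
  exact ⟨α, hα.1, hα.2.trans_lt hβ, h⟩

end CurlCurlWave

/-! ### The orbit as a function of parameter and time. -/

namespace CurlCurlWave

/-- The linear automorphism `(a, h) ↦ (a, A a + B h)` of the plane. -/
noncomputable def shearEquiv (A B : ℝ) (hB : B ≠ 0) : (ℝ × ℝ) ≃L[ℝ] (ℝ × ℝ) :=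
  ContinuousLinearEquiv.equivOfInverse
    ((ContinuousLinearMap.fst ℝ ℝ ℝ).prod
      (A • ContinuousLinearMap.fst ℝ ℝ ℝ + B • ContinuousLinearMap.snd ℝ ℝ ℝ))
    ((ContinuousLinearMap.fst ℝ ℝ ℝ).prod
      (B⁻¹ • (ContinuousLinearMap.snd ℝ ℝ ℝ - A • ContinuousLinearMap.fst ℝ ℝ ℝ)))
    (fun z => by ext <;> simp; field_simp)
    (fun z => by ext <;> simp; field_simp; ring)

/-- The angle reached at time `t` on the orbit with parameter `α`. -/
noncomputable def orbitAngle (p α : ℝ) : ℝ → ℝ := Function.invFun (orbitTime p α)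

/-- The displacement at the angle `θ` on the orbit with parameter `α`. -/
noncomputable def displacement (p : ℝ) : ℝ → ℝ → ℝ :=
  weightedPrimitive (sinPow p) Real.cos (angleTime p)

/-- The solution of `z'' + z - α |z|^{p-1} z = 0`, `z 0 = 0`, `z' 0 = 1`. -/
noncomputable def orbit (p α t : ℝ) : ℝ := displacement p α (orbitAngle p α t)

variable {p : ℝ}

theorem orbitTime_orbitAngle (hp : 1 < p) {α : ℝ} (hα : α < potMax p) (t : ℝ) :
    orbitTime p α (orbitAngle p α t) = t :=
  Function.rightInverse_invFun (surjective_orbitTime hp hα) t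

theorem orbitAngle_orbitTime (hp : 1 < p) {α : ℝ} (hα : α < potMax p) (θ : ℝ) :
    orbitAngle p α (orbitTime p α θ) = θ :=
  Function.leftInverse_invFun (strictMono_orbitTime hp hα).injective θ

theorem contDiffAt_angleTime_of_lt (hp : 1 < p) : ∀ v < potMax p, ContDiffAt ℝ 2 (angleTime p) v :=
  fun _ hv => contDiffAt_angleTime hp hv

/-- The `α`-derivative of `orbitTime`. -/
noncomputable def orbitTimeDeriv (p : ℝ) : ℝ → ℝ → ℝ :=
  weightedPrimitive (sinPow p) (sinPow p) (deriv (angleTime p))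

theorem hasFDerivAt_orbitTime (hp : 1 < p) {z : ℝ × ℝ} (hz : z.1 < potMax p) :
    HasFDerivAt (fun z : ℝ × ℝ => orbitTime p z.1 z.2)
      (orbitTimeDeriv p z.1 z.2 • ContinuousLinearMap.fst ℝ ℝ ℝ +
        angleTime p (z.1 * sinPow p z.2) • ContinuousLinearMap.snd ℝ ℝ ℝ) z := by
  have h := hasFDerivAt_weightedPrimitive (potMax_pos hp) (continuous_sinPow hp) sinPow_nonneg
    (sinPow_le_one hp) (continuous_const (y := (1 : ℝ)))
    (hasDerivAt_of_contDiffAt_two (contDiffAt_angleTime_of_lt hp))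
    (contDiffOn_deriv_of_contDiffAt_two (contDiffAt_angleTime_of_lt hp)).continuousOn hz
  simp only [weightedPrimitiveFDeriv, one_mul] at h
  exact h

theorem contDiffAt_orbitTime (hp : 1 < p) {z : ℝ × ℝ} (hz : z.1 < potMax p) :
    ContDiffAt ℝ 1 (fun z : ℝ × ℝ => orbitTime p z.1 z.2) z :=
  contDiffAt_weightedPrimitive (potMax_pos hp) (continuous_sinPow hp) sinPow_nonneg
    (sinPow_le_one hp) continuous_const
    (hasDerivAt_of_contDiffAt_two (contDiffAt_angleTime_of_lt hp))
    (contDiffOn_deriv_of_contDiffAt_two (contDiffAt_angleTime_of_lt hp)).continuousOn hz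

/-- In the coordinates `(α, θ)`, the passage from angle to time. -/
noncomputable def timeChart (p : ℝ) (z : ℝ × ℝ) : ℝ × ℝ := (z.1, orbitTime p z.1 z.2)

/-- In the coordinates `(α, t)`, the passage from time to angle. -/
noncomputable def angleChart (p : ℝ) (z : ℝ × ℝ) : ℝ × ℝ := (z.1, orbitAngle p z.1 z.2)

theorem timeChart_angleChart (hp : 1 < p) {z : ℝ × ℝ} (hz : z.1 < potMax p) :
    timeChart p (angleChart p z) = z := by
  simp [timeChart, angleChart, orbitTime_orbitAngle hp hz]

theorem angleChart_timeChart (hp : 1 < p) {z : ℝ × ℝ} (hz : z.1 < potMax p) :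
    angleChart p (timeChart p z) = z := by
  simp [timeChart, angleChart, orbitAngle_orbitTime hp hz]

theorem hasFDerivAt_timeChart (hp : 1 < p) {z : ℝ × ℝ} (hz : z.1 < potMax p) :
    HasFDerivAt (timeChart p) (shearEquiv (orbitTimeDeriv p z.1 z.2)
      (angleTime p (z.1 * sinPow p z.2)) (angleTime_pos hp (mul_sinPow_lt hp hz z.2)).ne' :
      ℝ × ℝ →L[ℝ] ℝ × ℝ) z :=
  hasFDerivAt_fst.prodMk (hasFDerivAt_orbitTime hp hz)

theorem contDiffAt_angleChart (hp : 1 < p) {z : ℝ × ℝ} (hz : z.1 < potMax p) :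
    ContDiffAt ℝ 1 (angleChart p) z := by
  have hz' : (angleChart p z).1 < potMax p := hz
  have h := ContDiffAt.of_eventually_leftInverse (f := timeChart p) (g := angleChart p)
    (contDiffAt_fst.prodMk (contDiffAt_orbitTime hp hz')) (hasFDerivAt_timeChart hp hz')
    one_ne_zero (by
      filter_upwards [(isOpen_fst_lt _).mem_nhds hz'] with y hy using angleChart_timeChart hp hy)
  rwa [timeChart_angleChart hp hz] at h

theorem hasFDerivAt_angleChart (hp : 1 < p) {z : ℝ × ℝ} (hz : z.1 < potMax p) :
    HasFDerivAt (angleChart p) ((shearEquiv (orbitTimeDeriv p z.1 (orbitAngle p z.1 z.2))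
      (angleTime p (z.1 * sinPow p (orbitAngle p z.1 z.2)))
      (angleTime_pos hp (mul_sinPow_lt hp hz _)).ne').symm : ℝ × ℝ →L[ℝ] ℝ × ℝ) z :=
  HasFDerivAt.of_local_left_inverse (contDiffAt_angleChart hp hz).continuousAt
    (hasFDerivAt_timeChart hp (z := angleChart p z) hz) (by
      filter_upwards [(isOpen_fst_lt _).mem_nhds hz] with y hy using timeChart_angleChart hp hy)

/-- The `α`-derivative of `displacement`. -/
noncomputable def displacementDeriv (p : ℝ) : ℝ → ℝ → ℝ :=
  weightedPrimitive (sinPow p) (fun φ => Real.cos φ * sinPow p φ) (deriv (angleTime p))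

/-- The inverse shear divides by `angleTime`, and the factor `angleTime` in the angular derivative
of the displacement cancels it. The factor that is merely continuous in the angle thus disappears
from the differential. -/
theorem hasFDerivAt_orbit (hp : 1 < p) {z : ℝ × ℝ} (hz : z.1 < potMax p) :
    HasFDerivAt (fun z : ℝ × ℝ => orbit p z.1 z.2)
      ((displacementDeriv p z.1 (orbitAngle p z.1 z.2) -
          Real.cos (orbitAngle p z.1 z.2) * orbitTimeDeriv p z.1 (orbitAngle p z.1 z.2)) •
          ContinuousLinearMap.fst ℝ ℝ ℝ +
        Real.cos (orbitAngle p z.1 z.2) • ContinuousLinearMap.snd ℝ ℝ ℝ) z := by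
  have h := hasFDerivAt_weightedPrimitive (potMax_pos hp) (continuous_sinPow hp) sinPow_nonneg
    (sinPow_le_one hp) Real.continuous_cos
    (hasDerivAt_of_contDiffAt_two (contDiffAt_angleTime_of_lt hp))
    (contDiffOn_deriv_of_contDiffAt_two (contDiffAt_angleTime_of_lt hp)).continuousOn
    (z := angleChart p z) hz
  have hB := (angleTime_pos hp (mul_sinPow_lt hp hz (orbitAngle p z.1 z.2))).ne'
  refine (h.comp z (hasFDerivAt_angleChart hp hz)).congr_fderiv ?_
  ext <;> simp [weightedPrimitiveFDeriv, shearEquiv, angleChart, displacementDeriv] <;> field_simp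
  ring

/-- The chart to the angle is known to be `C¹` only, but after the cancellation in
`hasFDerivAt_orbit` both partial derivatives are `C¹` functions of that chart; this gains the second
derivative. -/
theorem contDiffAt_orbit (hp : 1 < p) {z : ℝ × ℝ} (hz : z.1 < potMax p) :
    ContDiffAt ℝ 2 (fun z : ℝ × ℝ => orbit p z.1 z.2) z := by
  have hG := contDiffAt_angleChart hp hz
  have h1 := contDiffAt_weightedPrimitive (potMax_pos hp) (continuous_sinPow hp) sinPow_nonneg
    (sinPow_le_one hp) (continuous_sinPow hp)
    (hasDerivAt_deriv_of_contDiffAt_two (contDiffAt_angleTime_of_lt hp))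
    (continuousOn_deriv_deriv_of_contDiffAt_two (contDiffAt_angleTime_of_lt hp))
    (z := angleChart p z) hz
  have h2 := contDiffAt_weightedPrimitive (potMax_pos hp) (continuous_sinPow hp) sinPow_nonneg
    (sinPow_le_one hp) (Real.continuous_cos.mul (continuous_sinPow hp))
    (hasDerivAt_deriv_of_contDiffAt_two (contDiffAt_angleTime_of_lt hp))
    (continuousOn_deriv_deriv_of_contDiffAt_two (contDiffAt_angleTime_of_lt hp))
    (z := angleChart p z) hz
  have hcos : ContDiffAt ℝ 1 (fun z : ℝ × ℝ => Real.cos (orbitAngle p z.1 z.2)) z :=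
    (Real.contDiff_cos.contDiffAt).comp z (contDiffAt_snd.comp z hG)
  have key : ContDiffAt ℝ ((1 : ℕ) + 1) (fun z : ℝ × ℝ => orbit p z.1 z.2) z := by
    rw [contDiffAt_succ_iff_hasFDerivAt]
    refine ⟨_, ⟨_, (isOpen_fst_lt _).mem_nhds hz, fun y hy => hasFDerivAt_orbit hp hy⟩, ?_⟩
    exact (((h2.comp z hG).sub (hcos.mul (h1.comp z hG))).smul contDiffAt_const).add
      (hcos.smul contDiffAt_const)
  simpa [one_add_one_eq_two] using key

theorem hasDerivAt_orbit (hp : 1 < p) {α : ℝ} (hα : α < potMax p) (t : ℝ) :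
    HasDerivAt (orbit p α) (Real.cos (orbitAngle p α t)) t := by
  have h := (hasFDerivAt_orbit hp (z := (α, t)) hα).comp_hasDerivAt t
    ((hasDerivAt_const t α).prodMk (hasDerivAt_id t))
  simpa [Function.comp_def] using! h

/-- The integral form makes regularity in `α` visible; this closed form gives the equation of
motion, the bound and the periodicity. -/
theorem displacement_eq (hp : 1 < p) {α : ℝ} (hα : α < potMax p) (θ : ℝ) :
    displacement p α θ = Real.sin θ * orbitRatio p (α * sinPow p θ) := by
  have hd : ∀ φ ∈ Set.uIcc 0 θ, HasDerivAt
      (fun φ => Real.sin φ * orbitRatio p (α * |Real.sin φ| ^ (p - 1)))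
      (Real.cos φ * angleTime p (α * sinPow p φ)) φ := fun φ _ => by
    refine ((hasDerivAt_mul_orbitRatio hp (u := Real.sin φ) (mul_sinPow_lt hp hα φ)).comp φ
      (Real.hasDerivAt_sin φ)).congr_deriv ?_
    rw [mul_comm]; rfl
  have h := intervalIntegral.integral_eq_sub_of_hasDerivAt hd
    ((continuous_weighted_integrand (potMax_pos hp) (continuous_sinPow hp) sinPow_nonneg
      (sinPow_le_one hp) Real.continuous_cos (continuousOn_angleTime hp) hα).intervalIntegrable _ _)
  simp only [Real.sin_zero, zero_mul, sub_zero] at h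
  exact h

theorem hasDerivAt_orbitAngle (hp : 1 < p) {α : ℝ} (hα : α < potMax p) (t : ℝ) :
    HasDerivAt (orbitAngle p α) (angleTime p (α * sinPow p (orbitAngle p α t)))⁻¹ t := by
  refine HasDerivAt.of_local_left_inverse ?_ (hasDerivAt_orbitTime hp hα _)
    (angleTime_pos hp (mul_sinPow_lt hp hα _)).ne'
    (Eventually.of_forall (orbitTime_orbitAngle hp hα))
  exact ContinuousAt.comp (g := Prod.snd) (f := fun t => angleChart p (α, t)) continuousAt_snd
    (ContinuousAt.comp (g := angleChart p)
      (contDiffAt_angleChart hp (z := (α, t)) hα).continuousAt (by fun_prop))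

theorem mul_abs_orbit_rpow (hp : 1 < p) {α : ℝ} (hα : α < potMax p) (t : ℝ) :
    α * |orbit p α t| ^ (p - 1) = potInv p (α * sinPow p (orbitAngle p α t)) := by
  have hv := mul_sinPow_lt hp hα (orbitAngle p α t)
  have h := orbitRatio_pos hp hv
  rw [orbit, displacement_eq hp hα, abs_mul, Real.mul_rpow (abs_nonneg _) (abs_nonneg _),
    abs_of_pos h, ← mul_assoc]
  exact mul_orbitRatio_rpow hp hv

/-- The equation of motion. -/
theorem hasDerivAt_cos_orbitAngle (hp : 1 < p) {α : ℝ} (hα : α < potMax p) (t : ℝ) :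
    HasDerivAt (fun t => Real.cos (orbitAngle p α t))
      (α * |orbit p α t| ^ (p - 1) * orbit p α t - orbit p α t) t := by
  refine (hasDerivAt_orbitAngle hp hα t).cos.congr_deriv ?_
  rw [mul_abs_orbit_rpow hp hα, orbit, displacement_eq hp hα, ← orbitRatio_mul]
  ring

theorem abs_orbit_le (hp : 1 < p) {α : ℝ} (hα : α < potMax p) (t : ℝ) :
    |orbit p α t| ≤ (√(1 - potCoeff p))⁻¹ := by
  have hv := mul_sinPow_lt hp hα (orbitAngle p α t)
  rw [orbit, displacement_eq hp hα, abs_mul, abs_of_pos (orbitRatio_pos hp hv)]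
  have := orbitRatio_le hp hv
  calc _ ≤ 1 * orbitRatio p (α * sinPow p (orbitAngle p α t)) :=
        mul_le_mul_of_nonneg_right (Real.abs_sin_le_one _) (orbitRatio_pos hp hv).le
    _ ≤ _ := by rwa [one_mul]

theorem sinPow_add_two_pi (φ : ℝ) : sinPow p (φ + 2 * Real.pi) = sinPow p φ := by
  simp [sinPow]

theorem orbitTime_add_two_pi (hp : 1 < p) {α : ℝ} (hα : α < potMax p) (θ : ℝ) :
    orbitTime p α (θ + 2 * Real.pi) = orbitTime p α θ + orbitPeriod p α := by
  have hd : ∀ θ, HasDerivAt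
      (fun θ => orbitTime p α (θ + 2 * Real.pi) - orbitTime p α θ) 0 θ := fun θ => by
    refine (((hasDerivAt_orbitTime hp hα _).comp_add_const θ _).sub
      (hasDerivAt_orbitTime hp hα θ)).congr_deriv ?_
    rw [sinPow_add_two_pi, sub_self]
  have h := is_const_of_deriv_eq_zero (fun θ => (hd θ).differentiableAt) (fun θ => (hd θ).deriv) θ 0
  simp only [zero_add, orbitTime_zero, sub_zero] at h
  rw [orbitPeriod]
  linarith

theorem orbit_add_orbitPeriod (hp : 1 < p) {α : ℝ} (hα : α < potMax p) (t : ℝ) :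
    orbit p α (t + orbitPeriod p α) = orbit p α t := by
  have h : orbitAngle p α (t + orbitPeriod p α) = orbitAngle p α t + 2 * Real.pi := by
    rw [← orbitAngle_orbitTime hp hα (orbitAngle p α t + 2 * Real.pi),
      orbitTime_add_two_pi hp hα, orbitTime_orbitAngle hp hα]
  rw [orbit, orbit, displacement_eq hp hα, displacement_eq hp hα, h, sinPow_add_two_pi,
    Real.sin_add_two_pi]

theorem orbit_zero (hp : 1 < p) {α : ℝ} (hα : α < potMax p) : orbit p α 0 = 0 := by
  have h := orbitAngle_orbitTime hp hα 0
  rw [orbitTime_zero] at h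
  rw [orbit, h, displacement_eq hp hα, Real.sin_zero, zero_mul]

theorem exists_orbit_ne_zero (hp : 1 < p) {α : ℝ} (hα : α < potMax p) : ∃ t, orbit p α t ≠ 0 := by
  refine ⟨orbitTime p α (Real.pi / 2), ?_⟩
  rw [orbit, orbitAngle_orbitTime hp hα, displacement_eq hp hα, Real.sin_pi_div_two, one_mul]
  exact (orbitRatio_pos hp (mul_sinPow_lt hp hα _)).ne'

end CurlCurlWave

/-! ### Twice differentiability at the origin of `f(x) x/|x|`. -/

section
variable {E F : Type*} [NormedAddCommGroup E] [NormedSpace ℝ E] [NormedAddCommGroup F]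
  [NormedSpace ℝ F]

/-- A function vanishing at a puncture is controlled by its derivative along rays. -/
theorem norm_le_mul_pow_succ_of_norm_fderiv_le {g : E → F} {k : ℕ} {C r : ℝ}
    (hg : Tendsto g (𝓝[≠] 0) (𝓝 0)) (hd : ∀ x ≠ 0, ‖x‖ < r → DifferentiableAt ℝ g x)
    (hb : ∀ x ≠ 0, ‖x‖ < r → ‖fderiv ℝ g x‖ ≤ C * ‖x‖ ^ k) {x : E} (hx : x ≠ 0) (hxr : ‖x‖ < r) :
    ‖g x‖ ≤ C * ‖x‖ ^ (k + 1) := by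
  have hx0 := norm_pos_iff.2 hx
  have hC : 0 ≤ C := by
    by_contra! h
    have := (norm_nonneg _).trans (hb x hx hxr)
    nlinarith [pow_pos hx0 k]
  have hbound : ∀ s ∈ Set.Ioo (0 : ℝ) 1, ‖g x - g (s • x)‖ ≤ C * ‖x‖ ^ (k + 1) := by
    intro s hs
    have hin : ∀ c ∈ Set.Icc s 1, c • x ≠ 0 ∧ ‖c • x‖ ≤ ‖x‖ := fun c hc => by
      have hc0 : 0 < c := hs.1.trans_le hc.1
      refine ⟨smul_ne_zero hc0.ne' hx, ?_⟩
      rw [norm_smul, Real.norm_of_nonneg hc0.le]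
      nlinarith [hc.2]
    have h := norm_image_sub_le_of_norm_deriv_le_segment' (f := fun c : ℝ => g (c • x)) (a := s)
      (b := 1) (f' := fun c => fderiv ℝ g (c • x) x) (C := C * ‖x‖ ^ k * ‖x‖)
      (fun c hc => by
        have h1 := (hd _ (hin c hc).1 ((hin c hc).2.trans_lt hxr)).hasFDerivAt
        have h2 : HasDerivAt (fun c : ℝ => c • x) x c := by
          simpa using (hasDerivAt_id c).smul_const x
        exact (h1.comp_hasDerivAt c h2).hasDerivWithinAt)
      (fun c hc => by
        have hc' := hin c ⟨hc.1, hc.2.le⟩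
        refine (ContinuousLinearMap.le_opNorm _ _).trans ?_
        gcongr
        refine (hb _ hc'.1 (hc'.2.trans_lt hxr)).trans ?_
        gcongr
        exact hc'.2) 1 ⟨hs.2.le, le_rfl⟩
    simp only [one_smul] at h
    refine h.trans ?_
    rw [pow_succ, ← mul_assoc]
    have : 0 ≤ C * ‖x‖ ^ k * ‖x‖ := by positivity
    nlinarith [hs.1, hs.2]
  have hlim : Tendsto (fun s : ℝ => s • x) (𝓝[>] 0) (𝓝[≠] 0) := by
    refine tendsto_nhdsWithin_iff.2 ⟨?_, ?_⟩
    · have : Continuous fun s : ℝ => s • x := by fun_prop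
      simpa using (this.tendsto 0).mono_left nhdsWithin_le_nhds
    · filter_upwards [self_mem_nhdsWithin] with s hs
      exact smul_ne_zero (ne_of_gt hs) hx
  have hlim2 : Tendsto (fun s : ℝ => ‖g x - g (s • x)‖) (𝓝[>] 0) (𝓝 ‖g x‖) := by
    simpa using ((tendsto_const_nhds (x := g x)).sub (hg.comp hlim)).norm
  refine le_of_tendsto hlim2 ?_
  filter_upwards [Ioo_mem_nhdsGT zero_lt_one] with s hs using hbound s hs

theorem hasFDerivAt_zero_of_norm_le {g : E → F} (h0 : g 0 = 0)
    (hb : ∀ ε > 0, ∀ᶠ x in 𝓝[≠] (0 : E), ‖g x‖ ≤ ε * ‖x‖) : HasFDerivAt g (0 : E →L[ℝ] F) 0 := by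
  rw [hasFDerivAt_iff_isLittleO, Asymptotics.isLittleO_iff]
  intro ε hε
  have := hb ε hε
  rw [eventually_nhdsWithin_iff] at this
  filter_upwards [this] with x hx
  rcases eq_or_ne x 0 with rfl | hx0
  · simp [h0]
  · simpa [h0] using hx hx0

/-- A function that is `C²` off the origin and whose 2-jet at `x` is `O(|x|²), O(|x|), O(1)` with
arbitrarily small constants is `C²`. -/
theorem contDiff_two_of_jet_isLittleO {g : E → F} (h0 : g 0 = 0)
    (hg : ∀ x ≠ 0, ContDiffAt ℝ 2 g x)
    (hjet : ∀ ε > 0, ∀ᶠ x in 𝓝[≠] (0 : E), ‖g x‖ ≤ ε * ‖x‖ ^ 2 ∧ ‖fderiv ℝ g x‖ ≤ ε * ‖x‖ ∧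
      ‖fderiv ℝ (fderiv ℝ g) x‖ ≤ ε) : ContDiff ℝ 2 g := by
  have hsmall : ∀ᶠ x in 𝓝[≠] (0 : E), ‖x‖ ≤ 1 := by
    refine eventually_nhdsWithin_of_eventually_nhds ?_
    filter_upwards [Metric.closedBall_mem_nhds (0 : E) one_pos] with x hx
    simpa using hx
  have d0 : HasFDerivAt g (0 : E →L[ℝ] F) 0 := hasFDerivAt_zero_of_norm_le h0 fun ε hε => by
    filter_upwards [hjet ε hε, hsmall] with x hx hx1
    refine hx.1.trans ?_
    gcongr
    nlinarith [norm_nonneg x]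
  have d1 : HasFDerivAt (fderiv ℝ g) (0 : E →L[ℝ] E →L[ℝ] F) 0 :=
      hasFDerivAt_zero_of_norm_le d0.fderiv fun ε hε => by
    filter_upwards [hjet ε hε] with x hx using hx.2.1
  have h1 : ∀ x ≠ 0, ContDiffAt ℝ 1 (fderiv ℝ g) x := fun x hx =>
    (hg x hx).fderiv_right (m := 1) (by rw [one_add_one_eq_two])
  rw [← one_add_one_eq_two, contDiff_succ_iff_fderiv]
  refine ⟨fun x => ?_, by simp, ?_⟩
  · rcases eq_or_ne x 0 with rfl | hx
    · exact d0.differentiableAt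
    · exact (hg x hx).differentiableAt two_ne_zero
  rw [contDiff_one_iff_fderiv]
  refine ⟨fun x => ?_, continuous_iff_continuousAt.2 fun x => ?_⟩
  · rcases eq_or_ne x 0 with rfl | hx
    · exact d1.differentiableAt
    · exact (h1 x hx).differentiableAt one_ne_zero
  · rcases eq_or_ne x 0 with rfl | hx
    · rw [ContinuousAt, d1.fderiv, Metric.tendsto_nhds]
      intro ε hε
      have := hjet (ε / 2) (by positivity)
      rw [eventually_nhdsWithin_iff] at this
      filter_upwards [this] with x hx
      rcases eq_or_ne x 0 with rfl | hx0
      · simpa [d1.fderiv] using hε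
      · rw [dist_zero_right]
        linarith [(hx hx0).2.2]
    · exact ((h1 x hx).fderiv_right (m := 0) (by simp)).continuousAt

theorem norm_fderiv_smul_le {f : E → ℝ} {u : E → F} {x : E} (hf : DifferentiableAt ℝ f x)
    (hu : DifferentiableAt ℝ u x) :
    ‖fderiv ℝ (fun y => f y • u y) x‖ ≤ ‖f x‖ * ‖fderiv ℝ u x‖ + ‖fderiv ℝ f x‖ * ‖u x‖ := by
  rw [fderiv_fun_smul hf hu]
  refine (norm_add_le _ _).trans ?_
  rw [norm_smul, ContinuousLinearMap.norm_smulRight_apply]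

theorem norm_iteratedFDerivWithin_one_of_isOpen (g : E → F) {s : Set E} (hs : IsOpen s) {x : E}
    (hx : x ∈ s) : ‖iteratedFDerivWithin ℝ 1 g s x‖ = ‖fderiv ℝ g x‖ := by
  rw [iteratedFDerivWithin_of_isOpen 1 hs hx, norm_iteratedFDeriv_one]

theorem norm_iteratedFDerivWithin_two_of_isOpen (g : E → F) {s : Set E} (hs : IsOpen s) {x : E}
    (hx : x ∈ s) : ‖iteratedFDerivWithin ℝ 2 g s x‖ = ‖fderiv ℝ (fderiv ℝ g) x‖ := by
  rw [iteratedFDerivWithin_of_isOpen 2 hs hx, ← norm_iteratedFDeriv_one,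
    norm_iteratedFDeriv_fderiv]

theorem norm_fderiv_fderiv_smul_le {f : E → ℝ} {u : E → F} {s : Set E} (hs : IsOpen s)
    (hf : ContDiffOn ℝ 2 f s) (hu : ContDiffOn ℝ 2 u s) {x : E} (hx : x ∈ s) :
    ‖fderiv ℝ (fderiv ℝ (fun y => f y • u y)) x‖ ≤ ‖f x‖ * ‖fderiv ℝ (fderiv ℝ u) x‖ +
      2 * ‖fderiv ℝ f x‖ * ‖fderiv ℝ u x‖ + ‖fderiv ℝ (fderiv ℝ f) x‖ * ‖u x‖ := by
  have h := norm_iteratedFDerivWithin_smul_le hf hu hs.uniqueDiffOn hx (n := 2) le_rfl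
  simp only [Finset.sum_range_succ, Finset.sum_range_zero, Nat.sub_zero, Nat.choose_zero_right,
    Nat.choose_one_right, Nat.choose_self, norm_iteratedFDerivWithin_zero,
    norm_iteratedFDerivWithin_one_of_isOpen _ hs hx,
    norm_iteratedFDerivWithin_two_of_isOpen _ hs hx] at h
  simpa using h

end

section
variable {E : Type*} [NormedAddCommGroup E] [InnerProductSpace ℝ E]

theorem contDiffAt_norm_inv_smul {x : E} (hx : x ≠ 0) {n : WithTop ℕ∞} :
    ContDiffAt ℝ n (fun y : E => ‖y‖⁻¹ • y) x :=
  ((contDiffAt_norm ℝ hx).inv (norm_ne_zero_iff.2 hx)).smul contDiffAt_id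

theorem fderiv_eq_smul_of_homogeneous {F : Type*} [NormedAddCommGroup F] [NormedSpace ℝ F]
    {g : E → F} {a b : ℝ} (h : ∀ x, g x = b • g (a • x)) (x : E) :
    fderiv ℝ g x = (b * a) • fderiv ℝ g (a • x) := by
  have : g = fun x => b • g (a • x) := funext h
  conv_lhs => rw [this]
  have h2 := congrFun (fderiv_const_smul_field (𝕜 := ℝ) (f := fun x => g (a • x)) b) x
  rw [Pi.smul_apply, fderiv_comp_smul, smul_smul] at h2
  exact h2

theorem norm_fderiv_of_homogeneous {F : Type*} [NormedAddCommGroup F] [NormedSpace ℝ F]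
    {g : E → F} {a b : ℝ} (h : ∀ x, g x = b • g (a • x)) (x : E) :
    ‖fderiv ℝ g x‖ = |b * a| * ‖fderiv ℝ g (a • x)‖ := by
  rw [fderiv_eq_smul_of_homogeneous h, norm_smul, Real.norm_eq_abs]

/-- `x/|x|` is homogeneous of degree `0`, so its derivatives have degrees `-1` and `-2` and are
bounded by their maxima on the compact unit sphere. -/
theorem exists_norm_fderiv_unit_le [FiniteDimensional ℝ E] : ∃ C, ∀ x : E, x ≠ 0 →
    ‖fderiv ℝ (fun y : E => ‖y‖⁻¹ • y) x‖ ≤ C * ‖x‖⁻¹ ∧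
    ‖fderiv ℝ (fderiv ℝ (fun y : E => ‖y‖⁻¹ • y)) x‖ ≤ C * ‖x‖⁻¹ ^ 2 := by
  set u : E → E := fun y => ‖y‖⁻¹ • y
  have hne : ∀ x ∈ Metric.sphere (0 : E) 1, x ≠ 0 := fun x hx => by
    rintro rfl
    simp at hx
  have c1 : ∀ x ≠ 0, ContDiffAt ℝ 1 (fderiv ℝ u) x := fun x hx =>
    (contDiffAt_norm_inv_smul hx (n := 2)).fderiv_right (m := 1) (by rw [one_add_one_eq_two])
  obtain ⟨C₁, hC₁⟩ := (isCompact_sphere (0 : E) 1).exists_bound_of_continuousOn (f := fderiv ℝ u)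
    fun x hx => (c1 x (hne x hx)).continuousAt.continuousWithinAt
  obtain ⟨C₂, hC₂⟩ := (isCompact_sphere (0 : E) 1).exists_bound_of_continuousOn
    (f := fderiv ℝ (fderiv ℝ u))
    fun x hx => ((c1 x (hne x hx)).fderiv_right (m := 0)
      (by simp)).continuousAt.continuousWithinAt
  refine ⟨max C₁ C₂, fun x hx => ?_⟩
  have hx0 := norm_pos_iff.2 hx
  set a := ‖x‖⁻¹
  have ha : 0 < a := inv_pos.2 hx0
  have hmem : a • x ∈ Metric.sphere (0 : E) 1 := by
    rw [mem_sphere_zero_iff_norm, norm_smul, Real.norm_of_nonneg ha.le]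
    exact inv_mul_cancel₀ hx0.ne'
  have hu : ∀ y, u y = (1 : ℝ) • u (a • y) := fun y => by
    simp only [u, norm_smul, Real.norm_of_nonneg ha.le, smul_smul, one_mul]
    congr 1
    field_simp
  have h1 : ∀ y, fderiv ℝ u y = (1 * a) • fderiv ℝ u (a • y) := fderiv_eq_smul_of_homogeneous hu
  have h2 := norm_fderiv_of_homogeneous h1 x
  rw [norm_fderiv_of_homogeneous hu x, h2, one_mul, abs_of_pos ha, ← sq, abs_of_pos (by positivity),
    mul_comm, mul_comm (a ^ 2)]
  refine ⟨?_, ?_⟩ <;> gcongr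
  · exact (hC₁ _ hmem).trans (le_max_left _ _)
  · exact (hC₂ _ hmem).trans (le_max_right _ _)

/-- If `f → 0` in the `C²`-sense at the origin, then `f(x) x/|x|` is a `C²` vector field. -/
theorem contDiff_smul_unit [FiniteDimensional ℝ E] {f : E → ℝ}
    (hf : ∀ x ≠ 0, ContDiffAt ℝ 2 f x) (h0 : Tendsto f (𝓝[≠] 0) (𝓝 0))
    (h1 : Tendsto (fderiv ℝ f) (𝓝[≠] 0) (𝓝 0))
    (h2 : Tendsto (fderiv ℝ (fderiv ℝ f)) (𝓝[≠] 0) (𝓝 0)) :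
    ContDiff ℝ 2 fun x => f x • (‖x‖⁻¹ • x) := by
  obtain ⟨C, hC⟩ := exists_norm_fderiv_unit_le (E := E)
  refine contDiff_two_of_jet_isLittleO (by simp)
    (fun x hx => (hf x hx).smul (contDiffAt_norm_inv_smul hx)) fun ε hε => ?_
  -- The product rule for the second derivative contributes `|C| + 2|C| + 1`.
  set K := 1 + 3 * |C|
  have hK : 0 < K := by positivity
  have hball : ∃ r > 0, ∀ x : E, x ≠ 0 → ‖x‖ < r → ‖fderiv ℝ (fderiv ℝ f) x‖ ≤ ε / K := by
    have h3 := (tendsto_zero_iff_norm_tendsto_zero (E := E →L[ℝ] E →L[ℝ] ℝ)).1 h2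
    have h4 := h3.eventually_le_const (show 0 < ε / K by positivity)
    rw [eventually_nhdsWithin_iff, Metric.eventually_nhds_iff] at h4
    obtain ⟨r, hr, h⟩ := h4
    exact ⟨r, hr, fun x hx hxr => h (by rwa [dist_zero_right]) hx⟩
  obtain ⟨r, hr, hr2⟩ := hball
  have c1 : ∀ x ≠ 0, ContDiffAt ℝ 1 (fderiv ℝ f) x := fun x hx =>
    (hf x hx).fderiv_right (m := 1) (by rw [one_add_one_eq_two])
  -- Integrating twice along rays from the origin upgrades `D²f = o(1)` to `∇f = o(|x|)` and `f =
  -- o(|x|²)`, exactly compensating the blow-up of the derivatives of `x/|x|`.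
  have hr1 : ∀ x : E, x ≠ 0 → ‖x‖ < r → ‖fderiv ℝ f x‖ ≤ ε / K * ‖x‖ ^ 1 := fun x hx hxr =>
    norm_le_mul_pow_succ_of_norm_fderiv_le (k := 0) h1
      (fun x hx _ => (c1 x hx).differentiableAt one_ne_zero) (by simpa using hr2) hx hxr
  have hr0 : ∀ x : E, x ≠ 0 → ‖x‖ < r → ‖f x‖ ≤ ε / K * ‖x‖ ^ 2 := fun x hx hxr =>
    norm_le_mul_pow_succ_of_norm_fderiv_le (k := 1) h0
      (fun x hx _ => (hf x hx).differentiableAt two_ne_zero) hr1 hx hxr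
  have hev : ∀ᶠ x in 𝓝[≠] (0 : E), ‖x‖ < r := by
    refine eventually_nhdsWithin_of_eventually_nhds ?_
    filter_upwards [Metric.ball_mem_nhds (0 : E) hr] with x hx
    simpa using hx
  filter_upwards [hev, self_mem_nhdsWithin] with x hxr hx
  have hx : x ≠ 0 := hx
  have hx0 := norm_pos_iff.2 hx
  have hunit : ‖‖x‖⁻¹ • x‖ = 1 := by
    rw [norm_smul, norm_inv, norm_norm]; exact inv_mul_cancel₀ hx0.ne'
  obtain ⟨hu1, hu2⟩ := hC x hx
  have b0 := hr0 x hx hxr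
  have b1 := hr1 x hx hxr
  have b2 := hr2 x hx hxr
  rw [pow_one] at b1
  have hu1' : ‖fderiv ℝ (fun y : E => ‖y‖⁻¹ • y) x‖ ≤ |C| * ‖x‖⁻¹ :=
    hu1.trans (by gcongr; exact le_abs_self C)
  have hu2' : ‖fderiv ℝ (fderiv ℝ (fun y : E => ‖y‖⁻¹ • y)) x‖ ≤ |C| * ‖x‖⁻¹ ^ 2 :=
    hu2.trans (by gcongr; exact le_abs_self C)
  have hεK : 0 < ε / K := by positivity
  have hC0 := abs_nonneg C
  have hεKK : ε / K * K = ε := by field_simp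
  refine ⟨?_, ?_, ?_⟩
  · rw [norm_smul, hunit, mul_one]
    refine b0.trans ?_
    gcongr
    rw [div_le_iff₀ hK]
    nlinarith
  · refine (norm_fderiv_smul_le ((hf x hx).differentiableAt two_ne_zero)
      ((contDiffAt_norm_inv_smul hx (n := 2)).differentiableAt two_ne_zero)).trans ?_
    calc _ ≤ ε / K * ‖x‖ ^ 2 * (|C| * ‖x‖⁻¹) + ε / K * ‖x‖ * 1 := by
          rw [hunit]; gcongr
      _ = ε / K * (1 + |C|) * ‖x‖ := by field_simp; ring
      _ ≤ ε / K * K * ‖x‖ := by gcongr; simp only [K]; linarith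
      _ = ε * ‖x‖ := by rw [hεKK]
  · refine (norm_fderiv_fderiv_smul_le (s := {0}ᶜ) isOpen_compl_singleton
      (fun y hy => (hf y hy).contDiffWithinAt)
      (fun y hy => (contDiffAt_norm_inv_smul hy).contDiffWithinAt) hx).trans ?_
    calc _ ≤ ε / K * ‖x‖ ^ 2 * (|C| * ‖x‖⁻¹ ^ 2) + 2 * (ε / K * ‖x‖) * (|C| * ‖x‖⁻¹) +
          ε / K * 1 := by
          rw [hunit]; gcongr
      _ = ε / K * K := by simp only [K]; field_simp; ring
      _ = ε := hεKK

theorem hasFDerivAt_norm_of_ne_zero {x : E} (hx : x ≠ 0) :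
    HasFDerivAt (fun y : E => ‖y‖) (‖x‖⁻¹ • innerSL ℝ x) x := by
  have h := (hasStrictFDerivAt_norm_sq x).hasFDerivAt.sqrt (by simpa using hx)
  simp only [Real.sqrt_sq (norm_nonneg _)] at h
  refine h.congr_fderiv ?_
  ext y
  have := norm_ne_zero_iff.2 hx
  simp
  field_simp

end

/-! ### Radial fields: potentials, vanishing curl, phase shifts. -/

namespace CurlCurlWave

/-- A vector field is radial if `F(x) = ψ(|x|) x/|x|`. -/
def IsRadialVectorField (F : E3 → E3) : Prop :=
  ∃ ψ : ℝ → ℝ, ∀ x, F x = ψ ‖x‖ • (‖x‖⁻¹ • x)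

/-- A unit vector. -/
noncomputable def axis : E3 := EuclideanSpace.single 0 1

theorem norm_axis : ‖axis‖ = 1 := by simp [axis]

/-- The profile in the definition carries no regularity. Reading it off along a fixed axis yields
one that is continuous on the whole line whenever `F` is. -/
theorem IsRadialVectorField.eq_inner {F : E3 → E3} (h : IsRadialVectorField F) (x : E3) :
    F x = inner ℝ axis (F (‖x‖ • axis)) • (‖x‖⁻¹ • x) := by
  obtain ⟨ψ, hψ⟩ := h
  rcases eq_or_ne x 0 with rfl | hx
  · rw [hψ]; simp
  · have h0 := norm_ne_zero_iff.2 hx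
    have h1 : inner ℝ axis (F (‖x‖ • axis)) = ψ ‖x‖ := by
      rw [hψ, norm_smul, norm_norm, norm_axis, mul_one, smul_smul ‖x‖⁻¹,
        inv_mul_cancel₀ h0, one_smul, inner_smul_right, real_inner_self_eq_norm_sq, norm_axis]
      ring
    rw [h1, hψ]

/-- The radial potential of a radial vector field. -/
noncomputable def radialPotential (F : E3 → E3) (r : ℝ) : ℝ :=
  ∫ ρ in (0 : ℝ)..r, inner ℝ axis (F (ρ • axis))

/-- Off the origin this is the chain rule. At the origin `F` vanishes, so the potential is `o(r)`
there and the non-differentiability of the norm does no harm. -/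
theorem IsRadialVectorField.hasGradientAt {F : E3 → E3} (h : IsRadialVectorField F)
    (hF : Continuous F) (x : E3) :
    HasGradientAt (fun y : E3 => radialPotential F ‖y‖) (F x) x := by
  have hc : Continuous fun ρ : ℝ => inner ℝ axis (F (ρ • axis)) := by fun_prop
  have hd : ∀ r, HasDerivAt (radialPotential F) (inner ℝ axis (F (r • axis))) r := fun r =>
    hc.integral_hasStrictDerivAt 0 r |>.hasDerivAt
  rw [hasGradientAt_iff_hasFDerivAt]
  rcases eq_or_ne x 0 with rfl | hx
  · have h0 : F 0 = 0 := by rw [h.eq_inner]; simp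
    have hd0 := hd 0
    rw [zero_smul, h0, inner_zero_right, hasDerivAt_iff_isLittleO] at hd0
    rw [h0, map_zero, hasFDerivAt_iff_isLittleO]
    simp only [sub_zero, smul_zero] at hd0
    have := hd0.comp_tendsto (continuous_norm.tendsto' (0 : E3) 0 norm_zero)
    simp only [Function.comp_def] at this
    simpa using this.of_norm_right
  · refine ((hd ‖x‖).comp_hasFDerivAt x (hasFDerivAt_norm_of_ne_zero hx)).congr_fderiv ?_
    ext y
    conv_rhs => rw [h.eq_inner x]
    simp

/-- The Jacobian of `F` is the Hessian of its potential, hence symmetric. -/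
theorem IsRadialVectorField.curl_eq_zero {F : E3 → E3} (h : IsRadialVectorField F)
    (hF : ContDiff ℝ 1 F) : curl F = 0 := by
  funext x
  have hd : DifferentiableAt ℝ F x := hF.differentiable one_ne_zero x
  have hsymm : ∀ i j, partialDeriv F i j x = partialDeriv F j i x := by
    intro i j
    have h1 : ∀ y, HasFDerivAt (fun y : E3 => radialPotential F ‖y‖) (innerSL ℝ (F y)) y :=
      fun y => (h.hasGradientAt hF.continuous y).hasFDerivAt
    have h2 : HasFDerivAt (fun y => innerSL ℝ (F y)) ((innerSL ℝ).comp (fderiv ℝ F x)) x :=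
      (innerSL ℝ).hasFDerivAt.comp x hd.hasFDerivAt
    have h3 := second_derivative_symmetric h1 h2 (EuclideanSpace.single i 1)
      (EuclideanSpace.single j 1)
    simp only [ContinuousLinearMap.comp_apply, innerSL_apply_apply] at h3
    simp only [EuclideanSpace.inner_single_right, one_mul] at h3
    simpa [partialDeriv] using h3.symm
  simp only [curl]
  rw [hsymm 2 1, hsymm 0 2, hsymm 1 0, sub_self, sub_self, sub_self]
  ext i
  fin_cases i <;> simp

theorem curl_zero : curl 0 = 0 := by
  funext x
  ext i
  fin_cases i <;> simp [curl, partialDeriv]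

section phaseShift

variable {U : E3 × ℝ → E3} {a : E3 → ℝ}

theorem IsRadialField.slice (h : IsRadialField U) (t : ℝ) :
    IsRadialVectorField fun y => U (y, t) := by
  obtain ⟨ψ, hψ⟩ := h
  exact ⟨fun r => ψ r t, fun x => hψ x t⟩

theorem IsRadialField.isRadialGradient (h : IsRadialField U) (hU : Continuous U) :
    IsRadialGradient U :=
  ⟨fun r t => radialPotential (fun y => U (y, t)) r, fun x t =>
    (h.slice t).hasGradientAt (by fun_prop) x⟩

theorem IsRadialField.curl_curl_eq_zero (h : IsRadialField U) (hU : ContDiff ℝ 2 U) (t : ℝ) :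
    curl (curl fun y => U (y, t)) = 0 := by
  have h1 : ContDiff ℝ 1 fun y => U (y, t) :=
    (hU.of_le one_le_two).comp (contDiff_id.prodMk contDiff_const)
  rw [(h.slice t).curl_eq_zero h1, curl_zero]

theorem IsRadial.eq_axis {f : E3 → ℝ} (h : IsRadial f) (x : E3) : f x = f (‖x‖ • axis) :=
  h _ _ (by rw [norm_smul, norm_norm, norm_axis, mul_one])

theorem IsRadialField.phaseShift (h : IsRadialField U) (ha : IsRadial a) :
    IsRadialField (phaseShift U a) := by
  obtain ⟨ψ, hψ⟩ := h
  refine ⟨fun r t => ψ r (t + a (r • axis)), fun x t => ?_⟩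
  rw [CurlCurlWave.phaseShift, hψ, ha.eq_axis x]

theorem contDiff_phaseShift (hU : ContDiff ℝ 2 U) (ha : ContDiff ℝ 2 a) :
    ContDiff ℝ 2 (phaseShift U a) :=
  hU.comp (contDiff_fst.prodMk (contDiff_snd.add (ha.comp contDiff_fst)))

/-- Both fields are radial, so both curl terms vanish. What remains is, for each fixed `x`, an ODE
autonomous in `t`, and `a(x)` is a constant time translation for it. -/
theorem IsBreatherMinus.phaseShift {p : ℝ} {s q V : E3 → ℝ} {T δ : ℝ}
    (h : IsBreatherMinus p s q V T δ U) (hr : IsRadialField U) (ha : ContDiff ℝ 2 a)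
    (har : IsRadial a) : IsBreatherMinus p s q V T δ (phaseShift U a) := by
  have hc := contDiff_phaseShift h.solution.1 ha
  refine ⟨⟨hc, fun x t => ?_⟩, fun x t => ?_, ?_, ?_⟩
  · have h1 := h.solution.2 x (t + a x)
    rw [hr.curl_curl_eq_zero h.solution.1] at h1
    rw [(hr.phaseShift har).curl_curl_eq_zero hc]
    have h2 : iteratedDeriv 2 (fun τ => CurlCurlWave.phaseShift U a (x, τ)) t =
        iteratedDeriv 2 (fun τ => U (x, τ)) (t + a x) :=
      congrFun (iteratedDeriv_comp_add_const 2 (fun τ => U (x, τ)) (a x)) t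
    rw [h2]
    exact h1
  · simp only [CurlCurlWave.phaseShift]
    rw [add_right_comm, h.periodic]
  · obtain ⟨x, t, t', hne⟩ := h.nonstationary
    exact ⟨x, t - a x, t' - a x, by simpa [CurlCurlWave.phaseShift] using hne⟩
  · refine h.localized.mono ?_
    rintro _ ⟨z, rfl⟩
    exact ⟨(z.1, z.2 + a z.1), rfl⟩

/-- A continuous map is determined by its values on a countable dense set. -/
theorem mk_continuous_le_continuum {X Y : Type} [TopologicalSpace X] [TopologicalSpace Y]
    [TopologicalSpace.SeparableSpace X] [T2Space Y] (hY : Cardinal.mk Y ≤ Cardinal.continuum) :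
    Cardinal.mk {f : X → Y | Continuous f} ≤ Cardinal.continuum := by
  obtain ⟨D, hD, hDd⟩ := TopologicalSpace.exists_countable_dense X
  have hinj : Function.Injective fun (f : {f : X → Y | Continuous f}) (d : D) => f.1 d := by
    intro f g hfg
    exact Subtype.ext (Continuous.ext_on hDd f.2 g.2 fun d hd => congrFun hfg ⟨d, hd⟩)
  calc Cardinal.mk {f : X → Y | Continuous f} ≤ Cardinal.mk (D → Y) :=
        Cardinal.mk_le_of_injective hinj
    _ = Cardinal.mk Y ^ Cardinal.mk D := by simp
    _ ≤ Cardinal.continuum ^ Cardinal.aleph0 :=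
        (Cardinal.power_le_power_right hY).trans (Cardinal.power_le_power_left
          Cardinal.continuum_ne_zero (Cardinal.mk_le_aleph0_iff.2 hD.to_subtype))
    _ = Cardinal.continuum := Cardinal.continuum_power_aleph0

theorem mk_E3 : Cardinal.mk E3 = Cardinal.continuum := by
  have h : Cardinal.mk E3 = Cardinal.mk (Fin 3 → ℝ) :=
    Cardinal.mk_congr (WithLp.equiv 2 (Fin 3 → ℝ))
  rw [h]
  simp only [Cardinal.mk_pi, Cardinal.mk_real, Cardinal.prod_const, Cardinal.mk_fin,
    Cardinal.lift_id, Cardinal.power_natCast]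
  exact Cardinal.power_nat_eq Cardinal.aleph0_le_continuum (by norm_num)

/-- For the lower bound constant shifts suffice: at a point where a component of `U` varies in time,
their values at `t = 0` fill an interval. -/
theorem mk_phaseShiftFamily (hU : ContDiff ℝ 2 U)
    (hns : ∃ (x : E3) (t t' : ℝ), U (x, t) ≠ U (x, t')) :
    Cardinal.mk (phaseShiftFamily U) = Cardinal.continuum := by
  refine le_antisymm ?_ ?_
  · refine le_trans (Cardinal.mk_le_mk_of_subset ?_)
      (mk_continuous_le_continuum (X := E3 × ℝ) (Y := E3) mk_E3.le)
    rintro _ ⟨a, ha, -, rfl⟩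
    exact (contDiff_phaseShift hU ha).continuous
  · obtain ⟨x, t, t', hne⟩ := hns
    obtain ⟨i, hi⟩ : ∃ i, U (x, t) i ≠ U (x, t') i := by
      by_contra! h
      exact hne (by ext i; exact h i)
    have hUc := hU.continuous
    have hc : Continuous fun τ : ℝ => U (x, τ) i := by fun_prop
    have hsub : Set.uIcc (U (x, t) i) (U (x, t') i) ⊆
        (fun W : E3 × ℝ → E3 => W (x, 0) i) '' phaseShiftFamily U := by
      refine (intermediate_value_uIcc hc.continuousOn).trans ?_
      rintro _ ⟨τ, -, rfl⟩
      exact ⟨phaseShift U fun _ => τ, ⟨fun _ => τ, contDiff_const, fun _ _ _ => rfl, rfl⟩, by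
        simp [CurlCurlWave.phaseShift]⟩
    calc Cardinal.continuum = Cardinal.mk (Set.uIcc (U (x, t) i) (U (x, t') i)) :=
          (Cardinal.mk_Icc_real (by simpa [eq_comm] using hi)).symm
      _ ≤ _ := Cardinal.mk_le_mk_of_subset hsub
      _ ≤ _ := Cardinal.mk_image_le

end phaseShift

end CurlCurlWave

/-! ### Fitting the period, and assembling the breather. -/

namespace CurlCurlWave

variable {p : ℝ}

/-- `α` is the inverse of the period map composed with `2π + e`; the derivative of that map never
vanishes, not even at `α = 0`, so `α` inherits `C²` from `e`, including where `e = 0`. -/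
theorem exists_orbitParameter (hp : 1 < p) {e : E3 → ℝ} (he : ContDiff ℝ 2 e)
    (he0 : ∀ x, 0 ≤ e x) (hrad : IsRadial e) :
    ∃ α : E3 → ℝ, ContDiff ℝ 2 α ∧ IsRadial α ∧
      ∀ x, 0 ≤ α x ∧ α x < potMax p ∧ orbitPeriod p (α x) = 2 * Real.pi + e x := by
  choose α h0 h1 h2 using fun x => exists_orbitPeriod_eq hp (he0 x)
  have hinj := (strictMonoOn_orbitPeriod hp).injOn
  have hleft : ∀ a < potMax p,
      Function.invFunOn (orbitPeriod p) (Set.Iio (potMax p)) (orbitPeriod p a) = a :=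
    fun a ha => hinj.leftInvOn_invFunOn ha
  have hα : α = fun x =>
      Function.invFunOn (orbitPeriod p) (Set.Iio (potMax p)) (2 * Real.pi + e x) := by
    funext x
    rw [← h2, hleft _ (h1 x)]
  refine ⟨α, contDiff_iff_contDiffAt.2 fun x => ?_, fun x y hxy => ?_,
    fun x => ⟨h0 x, h1 x, h2 x⟩⟩
  · have hd : HasDerivAt (orbitPeriod p) (deriv (orbitPeriod p) (α x)) (α x) :=
      ((contDiffAt_orbitPeriod hp (h1 x)).differentiableAt two_ne_zero).hasDerivAt
    have h := (contDiffAt_orbitPeriod hp (h1 x)).of_eventually_leftInverse_real hd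
      (deriv_orbitPeriod_pos hp (h1 x)).ne' two_ne_zero
      (by filter_upwards [Iio_mem_nhds (h1 x)] with a ha using hleft a ha)
    rw [h2] at h
    rw [hα]
    exact h.comp x (contDiffAt_const.add he.contDiffAt)
  · exact hinj (h1 x) (h1 y) (by rw [h2, h2, hrad x y hxy])

/-- The standing wave with amplitude `A`, orbit parameter `α` and frequency `κ`. -/
theorem iteratedDeriv_two_standingWave (hp : 1 < p) {α : ℝ} (hα : α < potMax p) (A κ : ℝ) (w : E3)
    (t : ℝ) : iteratedDeriv 2 (fun τ => (A * orbit p α (κ * τ)) • w) t =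
      (A * κ ^ 2 * (α * |orbit p α (κ * t)| ^ (p - 1) * orbit p α (κ * t) -
        orbit p α (κ * t))) • w := by
  have hmul : ∀ t, HasDerivAt (fun τ => κ * τ) κ t := fun t => by
    simpa using (hasDerivAt_id t).const_mul κ
  have h1 : deriv (fun τ => (A * orbit p α (κ * τ)) • w) =
      fun τ => (A * (Real.cos (orbitAngle p α (κ * τ)) * κ)) • w := funext fun τ =>
    ((((hasDerivAt_orbit hp hα (κ * τ)).comp τ (hmul τ)).const_mul A).smul_const w).deriv
  rw [iteratedDeriv_succ, iteratedDeriv_one, h1]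
  refine ((((((hasDerivAt_cos_orbitAngle hp hα (κ * t)).comp t (hmul t)).mul_const
    κ).const_mul A).smul_const w).deriv).trans ?_
  congr 1
  ring

/-- The relation between `A` and `α` matches the nonlinear term of the rescaled ODE with `V
|U|^{p-1} U`. The alternative `A = 0` serves the origin, where there is no unit direction. -/
theorem standingWave_equation (hp : 1 < p) {α : ℝ} (hα : α < potMax p) {A s q V : ℝ} (hs : 0 < s)
    (hq : 0 < q) (hV : 0 < V) (hA0 : 0 ≤ A) (hA : A ^ (p - 1) = q / V * α) {w : E3}
    (hw : A = 0 ∨ ‖w‖ = 1) (t : ℝ) :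
    s • iteratedDeriv 2 (fun τ => (A * orbit p α (√(q / s) * τ)) • w) t +
      q • ((A * orbit p α (√(q / s) * t)) • w) -
      (V * ‖(A * orbit p α (√(q / s) * t)) • w‖ ^ (p - 1)) •
        ((A * orbit p α (√(q / s) * t)) • w) = 0 := by
  rw [iteratedDeriv_two_standingWave hp hα, Real.sq_sqrt (by positivity)]
  rcases hw with rfl | hw
  · simp
  · set z := orbit p α (√(q / s) * t)
    have hn : ‖(A * z) • w‖ ^ (p - 1) = q / V * α * |z| ^ (p - 1) := by
      rw [norm_smul, hw, mul_one, Real.norm_eq_abs, abs_mul, abs_of_nonneg hA0,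
        Real.mul_rpow hA0 (abs_nonneg z), hA]
    rw [hn, smul_smul, smul_smul, smul_smul, ← add_smul, ← sub_smul]
    have : s * (A * (q / s) * (α * |z| ^ (p - 1) * z - z)) + q * (A * z) -
        V * (q / V * α * |z| ^ (p - 1)) * (A * z) = 0 := by
      field_simp
      ring
    rw [this, zero_smul]

end CurlCurlWave

open CurlCurlWave in
theorem theorem2 (p : ℝ) (hp : 1 < p)
    (s q V : CurlCurlWave.E3 → ℝ)
    (hs : ContDiff ℝ 2 s) (hq : ContDiff ℝ 2 q) (hV : ContDiff ℝ 2 V)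
    (hs_pos : ∀ x, 0 < s x) (hq_pos : ∀ x, 0 < q x) (hV_pos : ∀ x, 0 < V x)
    (hs_rad : CurlCurlWave.IsRadial s) (hq_rad : CurlCurlWave.IsRadial q)
    (hV_rad : CurlCurlWave.IsRadial V)
    (T : ℝ) (hT : T = 2 * Real.pi * Real.sqrt (s 0 / q 0))
    (H1' : ∀ x : CurlCurlWave.E3, x ≠ 0 → 2 * Real.pi < T * Real.sqrt (q x / s x))
    (H2 : CurlCurlWave.TendsToZeroC2
      (fun x => |2 * Real.pi - T * Real.sqrt (q x / s x)| ^ (1 / (p - 1))))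
    (δ : ℝ) (hδ : 0 < δ)
    (H3 : BddAbove (Set.range fun x : CurlCurlWave.E3 =>
      |2 * Real.pi - T * Real.sqrt (q x / s x)| * Real.exp (δ * (p - 1) * ‖x‖)))
    (H4 : BddAbove (Set.range fun x : CurlCurlWave.E3 => q x / V x)) :
    ∃ U : CurlCurlWave.E3 × ℝ → CurlCurlWave.E3,
      CurlCurlWave.IsBreatherMinus p s q V T δ U ∧
      CurlCurlWave.IsRadialField U ∧
      CurlCurlWave.IsRadialGradient U ∧
      (∀ a : CurlCurlWave.E3 → ℝ, ContDiff ℝ 2 a → CurlCurlWave.IsRadial a →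
        CurlCurlWave.IsBreatherMinus p s q V T δ (CurlCurlWave.phaseShift U a)) ∧
      Cardinal.mk (CurlCurlWave.phaseShiftFamily U) = Cardinal.continuum := by
  have hp1 : 0 < p - 1 := by linarith
  have hr : 0 < 1 / (p - 1) := by positivity
  have hκ : ContDiff ℝ 2 fun x => √(q x / s x) :=
    (hq.div hs fun x => (hs_pos x).ne').sqrt fun x => (div_pos (hq_pos x) (hs_pos x)).ne'
  set e : E3 → ℝ := fun x => T * √(q x / s x) - 2 * Real.pi with he_def
  have he : ContDiff ℝ 2 e := (contDiff_const.mul hκ).sub contDiff_const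
  have he_zero : e 0 = 0 := by
    -- `T` is the period of the linear oscillator at the origin, which forces `e 0 = 0`.
    have h1 : √(s 0 / q 0) * √(q 0 / s 0) = 1 := by
      rw [← Real.sqrt_mul (div_pos (hs_pos 0) (hq_pos 0)).le,
        div_mul_div_cancel₀ (hq_pos 0).ne', div_self (hs_pos 0).ne', Real.sqrt_one]
    simp only [e, hT]
    rw [mul_assoc, h1]
    ring
  have he_pos : ∀ x ≠ 0, 0 < e x := fun x hx => sub_pos.2 (H1' x hx)
  have he_nonneg : ∀ x, 0 ≤ e x := fun x => by
    rcases eq_or_ne x 0 with rfl | hx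
    · exact he_zero.ge
    · exact (he_pos x hx).le
  have he_abs : ∀ x, |2 * Real.pi - T * √(q x / s x)| = e x := fun x => by
    rw [abs_sub_comm, abs_of_nonneg (he_nonneg x)]
  simp only [he_abs] at H2 H3
  have he_rad : IsRadial e := fun x y hxy => by
    simp only [e, hq_rad x y hxy, hs_rad x y hxy]
  obtain ⟨α, hα, hα_rad, hα_spec⟩ := exists_orbitParameter hp he he_nonneg he_rad
  have hαlt : ∀ x, α x < potMax p := fun x => (hα_spec x).2.1
  have hP_pos : ∀ x, 0 < periodQuot p (α x) := fun x => periodQuot_pos hp (hαlt x)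
  have he_eq : ∀ x, e x = α x * periodQuot p (α x) := fun x => by
    have h1 := (hα_spec x).2.2
    rw [orbitPeriod_eq hp (hαlt x)] at h1
    linarith
  have hB_pos : ∀ x, 0 < q x / V x / periodQuot p (α x) := fun x =>
    div_pos (div_pos (hq_pos x) (hV_pos x)) (hP_pos x)
  -- Amplitude `A = B f`: since `α = e / P(α)`, the root of `(q/V) α` splits into a positive `C²`
  -- factor and the root of `e`, the only one that can be singular at the origin.
  set B : E3 → ℝ := fun x => (q x / V x / periodQuot p (α x)) ^ (1 / (p - 1)) with hB_def
  set f : E3 → ℝ := fun x => e x ^ (1 / (p - 1)) with hf_def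
  have hf_nonneg : ∀ x, 0 ≤ f x := fun x => Real.rpow_nonneg (he_nonneg x) _
  have hB_nonneg : ∀ x, 0 ≤ B x := fun x => Real.rpow_nonneg (hB_pos x).le _
  have hf0 : f 0 = 0 := by simp only [f, he_zero, Real.zero_rpow hr.ne']
  have hpow : ∀ {y : ℝ}, 0 ≤ y → (y ^ (1 / (p - 1))) ^ (p - 1) = y := fun {y} hy => by
    rw [← Real.rpow_mul hy, one_div_mul_cancel hp1.ne', Real.rpow_one]
  have hA : ∀ x, (B x * f x) ^ (p - 1) = q x / V x * α x := fun x => by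
    rw [Real.mul_rpow (hB_nonneg x) (hf_nonneg x), hpow (hB_pos x).le, hpow (he_nonneg x), he_eq]
    have := (hP_pos x).ne'
    field_simp
  have hB : ContDiff ℝ 2 B :=
    ((hq.div hV fun x => (hV_pos x).ne').div (contDiff_iff_contDiffAt.2 fun x =>
      (contDiffAt_periodQuot hp (hαlt x)).comp x hα.contDiffAt)
      fun x => (hP_pos x).ne').rpow_const_of_ne fun x => (hB_pos x).ne'
  have hX : ContDiff ℝ 2 fun x : E3 => f x • (‖x‖⁻¹ • x) :=
    contDiff_smul_unit (fun x hx => he.contDiffAt.rpow_const_of_ne (he_pos x hx).ne')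
      H2.2.1 H2.2.2.1 H2.2.2.2
  -- The factor `f` is kept together with `x/|x|`, since their product is `C²` at the origin while
  -- `x/|x|` alone is not.
  set U : E3 × ℝ → E3 := fun z =>
    (B z.1 * orbit p (α z.1) (√(q z.1 / s z.1) * z.2)) • (f z.1 • (‖z.1‖⁻¹ • z.1)) with hU_def
  have hU_eq : ∀ x t, U (x, t) =
      (B x * f x * orbit p (α x) (√(q x / s x) * t)) • (‖x‖⁻¹ • x) := fun x t => by
    simp only [U]
    rw [smul_smul]
    congr 1
    ring
  have hU : ContDiff ℝ 2 U := by
    refine ContDiff.smul ((hB.comp contDiff_fst).mul ?_) (hX.comp contDiff_fst)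
    refine contDiff_iff_contDiffAt.2 fun z => ?_
    exact (contDiffAt_orbit hp (z := (α z.1, √(q z.1 / s z.1) * z.2)) (hαlt z.1)).comp z
      ((hα.comp contDiff_fst).prodMk ((hκ.comp contDiff_fst).mul contDiff_snd)).contDiffAt
  have hU_rad : IsRadialField U := by
    refine ⟨fun r t => B (r • axis) * f (r • axis) *
      orbit p (α (r • axis)) (√(q (r • axis) / s (r • axis)) * t), fun x t => ?_⟩
    have hB_rad : IsRadial B := fun x y hxy => by
      simp only [B, hq_rad x y hxy, hV_rad x y hxy, hα_rad x y hxy]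
    have hf_rad : IsRadial f := fun x y hxy => by simp only [f, he_rad x y hxy]
    rw [hU_eq, hB_rad.eq_axis x, hf_rad.eq_axis x, hα_rad.eq_axis x, hq_rad.eq_axis x,
      hs_rad.eq_axis x]
  have hns : ∃ (x : E3) (t t' : ℝ), U (x, t) ≠ U (x, t') := by
    have hne : axis ≠ 0 := by
      rw [← norm_ne_zero_iff, norm_axis]
      exact one_ne_zero
    obtain ⟨τ, hτ⟩ := exists_orbit_ne_zero hp (hαlt axis)
    have hκ0 : √(q axis / s axis) ≠ 0 :=
      (Real.sqrt_pos.2 (div_pos (hq_pos axis) (hs_pos axis))).ne'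
    refine ⟨axis, τ / √(q axis / s axis), 0, ?_⟩
    rw [hU_eq, hU_eq, mul_zero, orbit_zero hp (hαlt axis), mul_zero, zero_smul,
      mul_div_cancel₀ _ hκ0, norm_axis, inv_one, one_smul]
    exact smul_ne_zero (mul_ne_zero (mul_ne_zero (Real.rpow_pos_of_pos (hB_pos axis) _).ne'
      (Real.rpow_pos_of_pos (he_pos axis hne) _).ne') hτ) hne
  have hsol : IsBreatherMinus p s q V T δ U := by
    refine ⟨⟨hU, fun x t => ?_⟩, fun x t => ?_, hns, ?_⟩
    · rw [hU_rad.curl_curl_eq_zero hU, Pi.zero_apply, add_zero]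
      simp only [hU_eq]
      refine standingWave_equation hp (hαlt x) (hs_pos x) (hq_pos x) (hV_pos x)
        (mul_nonneg (hB_nonneg x) (hf_nonneg x)) (hA x) ?_ t
      rcases eq_or_ne x 0 with rfl | hx
      · exact Or.inl (by rw [hf0, mul_zero])
      · refine Or.inr ?_
        rw [norm_smul, norm_inv, norm_norm]
        exact inv_mul_cancel₀ (norm_ne_zero_iff.2 hx)
    · have h1 : √(q x / s x) * (t + T) = √(q x / s x) * t + orbitPeriod p (α x) := by
        rw [(hα_spec x).2.2]
        simp only [e]
        ring
      rw [hU_eq, hU_eq, h1, orbit_add_orbitPeriod hp (hαlt x)]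
    · obtain ⟨C₃, hC₃⟩ := H3
      obtain ⟨C₄, hC₄⟩ := H4
      -- Lower bound for `periodQuot p (α x)` uniform in `x`, valid because `α ≥ 0`; with (H4) it
      -- bounds `B`.
      set P₀ := (1 - potCoeff p) / 2 * ∫ φ in (0 : ℝ)..2 * Real.pi, sinPow p φ
      have hP₀ : 0 < P₀ :=
        mul_pos (by linarith [potCoeff_lt_one hp]) (integral_sinPow_pos hp)
      refine ⟨(C₄ / P₀) ^ (1 / (p - 1)) * (√(1 - potCoeff p))⁻¹ * C₃ ^ (1 / (p - 1)), ?_⟩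
      rintro _ ⟨⟨x, t⟩, rfl⟩
      have hbB : B x ≤ (C₄ / P₀) ^ (1 / (p - 1)) := by
        refine Real.rpow_le_rpow (hB_pos x).le ?_ hr.le
        have h4 : q x / V x ≤ C₄ := hC₄ ⟨x, rfl⟩
        exact div_le_div₀ ((div_pos (hq_pos x) (hV_pos x)).le.trans h4) h4 hP₀
          (le_periodQuot hp (hα_spec x).1 (hαlt x))
      have hbf : f x * Real.exp (δ * ‖x‖) ≤ C₃ ^ (1 / (p - 1)) := by
        have h3 : e x * Real.exp (δ * (p - 1) * ‖x‖) ≤ C₃ := hC₃ ⟨x, rfl⟩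
        have h5 : Real.exp (δ * ‖x‖) = Real.exp (δ * (p - 1) * ‖x‖) ^ (1 / (p - 1)) := by
          rw [← Real.exp_mul]
          congr 1
          field_simp
        rw [h5, ← Real.mul_rpow (he_nonneg x) (Real.exp_pos _).le]
        exact Real.rpow_le_rpow (mul_nonneg (he_nonneg x) (Real.exp_pos _).le) h3 hr.le
      have hbz := abs_orbit_le hp (hαlt x) (√(q x / s x) * t)
      have hbu : ‖‖x‖⁻¹ • x‖ ≤ 1 := by
        rw [norm_smul, norm_inv, norm_norm]
        exact inv_mul_le_one
      have hbB0 := (hB_nonneg x).trans hbB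
      simp only
      rw [hU_eq, norm_smul, Real.norm_eq_abs, abs_mul, abs_of_nonneg
        (mul_nonneg (hB_nonneg x) (hf_nonneg x))]
      calc _ = B x * |orbit p (α x) (√(q x / s x) * t)| * (f x * Real.exp (δ * ‖x‖)) *
            ‖‖x‖⁻¹ • x‖ := by ring
        _ ≤ (C₄ / P₀) ^ (1 / (p - 1)) * (√(1 - potCoeff p))⁻¹ * C₃ ^ (1 / (p - 1)) * 1 := by
            have h6 := (mul_nonneg (hf_nonneg x) (Real.exp_pos (δ * ‖x‖)).le).trans hbf
            have h7 := mul_nonneg (hf_nonneg x) (Real.exp_pos (δ * ‖x‖)).le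
            gcongr
        _ = _ := mul_one _
  exact ⟨U, hsol, hU_rad, hU_rad.isRadialGradient hU.continuous,
    fun a ha har => hsol.phaseShift hU_rad ha har, mk_phaseShiftFamily hU hns⟩
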